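/- Let $X$ be a compact connected Riemann surface, $k=\mathbb C(X)$ its field of meromorphic functions, $v$ a nonzero meromorphic tangent field on $X$, and $E$ a meromorphic vector bundle of rank $n\ge 1$ on $X$ with global meromorphic frame $e=(e_1,\dots,e_n)$. Let $\nabla$ be a meromorphic connection on $E$ and write $\nabla_v e_j=-\sum_i a^i_j e_i$ with $a^i_j\in k$. A *full system of solutions* of $\nabla$ in the frame $e$ over a connected non-empty open set $U\subseteq X$ is a matrix $y=(y^i_j)$ of meromorphic functions on $U$ with $v(y^i_j)=\sum_l a^i_l y^l_j$ and $\det y\neq 0$. The Galois group $G\subseteq \mathrm{GL}_n(\mathbb C)$ (relative to $y$) consists of the $g$ such that $X^i_j\mapsto\sum_l X^i_l g^l_j$ maps the ideal of polynomial relations over $k$ among the $y^i_j$ onto itself. Let $\mathbb C[X^i_j]^G$ be the graded algebra of polynomials invariant under these substitutions, and let $J$ be the largest homogeneous ideal contained in the kernel of $\mathbb C[X^i_j]^G\to\mathcal M(U)$, $P\mapsto P(y)$. The *projective Fano curve* $X_0$ of $\nabla$ (in the frame $e$) is the non-singular model (normalization) of the projective variety $Z(J)=\operatorname{Proj}(\mathbb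 C[X^i_j]^G/J)\subseteq\operatorname{Proj}(\mathbb C[X^i_j]^G)$. Its function field is identified with the field $\mathbb C(X_0)\subseteq\mathcal M(U)$ of all quotients $P(y)/Q(y)$, where $P,Q\in\mathbb C[X^i_j]^G$ are homogeneous of the same degree and $Q(y)\ne0$. Let $\nabla_1$ be a second meromorphic connection on $E$ that is projectively equivalent to $\nabla$: there are a meromorphic line bundle $L$ with a meromorphic connection $\nabla'$ and a horizontal isomorphism $\tau:(E,\nabla_1)\to(L\otimes E,\nabla'\otimes\nabla)$. Let $s$ be a non-zero global meromorphic section of $L$ and let $e_1'=\tau^{-1}(s\otimes e_1),\dots,e_n'=\tau^{-1}(s\otimes e_n)$ be the frame of $E$ corresponding to $e$ (so $e'=e$ if $E$ and $L\otimes E$ are identified by $\tau=s\otimes\cdot$). Let $y$ and $y_1$ be arbitrary full systems of solutions over the same $U$ of $\nabla$ in the frame $e$ and of $\nabla_1$ in the frame $e'$. Assume that the Galois group of $\nabla$ is reductive and unimodular (contained in $\mathrm{SL}_n(\mathbb C)$) and that the Galois group of $\nabla_1$ is unimodular. Then the projective Fano curves of $\nabla$ (in the frame $e$) and of $\nabla_1$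 (in the frame $e'$) coincide. Precisely: the two function fields are equal as subfields of $\mathcal M(U)$; both projective varieties $Z(J)$, $Z(J_1)$ are integral; and there is an isomorphism $Z(J)\cong Z(J_1)$ over $\mathbb C$ that lifts to an isomorphism of the projective Fano curves. -/

import Mathlib

open scoped Manifold ContDiff Topology TensorProduct

noncomputable section

namespace FanoCurve

/-! ### Meromorphic functions on open subsets of a Riemann surface -/

section Meromorphic

variable {X : Type*} [TopologicalSpace X] [ChartedSpace ℂ X]

/-- `f` is meromorphic at `p`: it is so when read in the preferred chart at `p`. -/
def MeroAt (f : X → ℂ) (p : X) : Prop :=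
  MeromorphicAt (fun w => f ((chartAt ℂ p).symm w)) (chartAt ℂ p p)

variable (X) in
/-- The functions `X → ℂ` that are meromorphic at every point of `U` (with arbitrary values at the
poles and outside `U`). -/
def preMero (U : TopologicalSpace.Opens X) : Subalgebra ℂ (X → ℂ) where
  carrier := {f | ∀ p ∈ U, MeroAt f p}
  mul_mem' hf hg p hp := (hf p hp).mul (hg p hp)
  add_mem' hf hg p hp := (hf p hp).add (hg p hp)
  algebraMap_mem' c _ _ := MeromorphicAt.const c _

/-- The functions that vanish on `U` outside a subset of isolated points of `U`. -/
def negligible (U : TopologicalSpace.Opens X) : Ideal (preMero X U) where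
  carrier := {f | ∀ p ∈ U, ∀ᶠ q in 𝓝[≠] p, f.1 q = 0}
  zero_mem' _ _ := Filter.Eventually.of_forall fun _ => rfl
  add_mem' {f g} hf hg p hp := by
    filter_upwards [hf p hp, hg p hp] with q h1 h2
    simp [h1, h2]
  smul_mem' c f hf p hp := by
    filter_upwards [hf p hp] with q h
    simp [h]

variable (X) in
/-- The `ℂ`-algebra `𝓜(U)` of meromorphic functions on `U`: two meromorphic functions are
identified when they agree on `U` outside a set of isolated points. -/
def Mero (U : TopologicalSpace.Opens X) : Type _ := preMero X U ⧸ negligible U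

instance (U : TopologicalSpace.Opens X) : CommRing (Mero X U) :=
  inferInstanceAs (CommRing (preMero X U ⧸ negligible U))

instance (U : TopologicalSpace.Opens X) : Algebra ℂ (Mero X U) :=
  inferInstanceAs (Algebra ℂ (preMero X U ⧸ negligible U))

/-- The class of a function in `𝓜(U)`. -/
def Mero.mk (U : TopologicalSpace.Opens X) : preMero X U →ₐ[ℂ] Mero X U :=
  Ideal.Quotient.mkₐ ℂ (negligible U)

lemma Mero.mk_surjective (U : TopologicalSpace.Opens X) : Function.Surjective (Mero.mk U) :=
  Ideal.Quotient.mkₐ_surjective ℂ (negligible U)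

lemma Mero.mk_eq_zero (U : TopologicalSpace.Opens X) (f : preMero X U) :
    Mero.mk U f = 0 ↔ ∀ p ∈ U, ∀ᶠ q in 𝓝[≠] p, f.1 q = 0 :=
  Ideal.Quotient.eq_zero_iff_mem

lemma Mero.mk_eq (U : TopologicalSpace.Opens X) (f g : preMero X U) :
    Mero.mk U f = Mero.mk U g ↔ ∀ p ∈ U, ∀ᶠ q in 𝓝[≠] p, f.1 q = g.1 q := by
  rw [← sub_eq_zero, ← map_sub, Mero.mk_eq_zero]
  simp [sub_eq_zero]

/-- The restriction map from `k = 𝓜(X)` to `𝓜(U)`. -/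
def restrict (U : TopologicalSpace.Opens X) : Mero X ⊤ →ₐ[ℂ] Mero X U :=
  Ideal.Quotient.liftₐ (negligible ⊤)
    ((Mero.mk U).comp (Subalgebra.inclusion (S := preMero X ⊤) (T := preMero X U)
      (fun _ hf p _ => hf p trivial)))
    (fun _ hf => (Mero.mk_eq_zero U _).2 fun p _ => hf p trivial)

/-- The derivative `w(f)` of a function `f` along a tangent vector `w` at `q`. -/
def along (f : X → ℂ) (q : X) (w : TangentSpace 𝓘(ℂ, ℂ) q) : ℂ :=
  mfderiv 𝓘(ℂ, ℂ) 𝓘(ℂ, ℂ) f q w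

variable (X) in
/-- A meromorphic tangent field on `X`: in every chart `z` its coefficient `v(z)` is
meromorphic. -/
structure MeroField where
  toFun : ∀ p : X, TangentSpace 𝓘(ℂ, ℂ) p
  mero : ∀ p : X, MeromorphicAt (fun w : ℂ =>
    along (chartAt ℂ p) ((chartAt ℂ p).symm w) (toFun ((chartAt ℂ p).symm w))) (chartAt ℂ p p)

/-- `v` is not the zero meromorphic field, i.e. it does not vanish outside isolated points. -/
def MeroField.IsNonzero (v : MeroField X) : Prop :=
  ¬ ∀ p : X, ∀ᶠ q in 𝓝[≠] p, v.toFun q = 0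

/-- The function `v(f) : q ↦ v_q(f)`. -/
def MeroField.apply (v : MeroField X) (f : X → ℂ) (q : X) : ℂ := along f q (v.toFun q)

lemma MeroField.apply_const (v : MeroField X) (c : ℂ) (q : X) :
    v.apply (fun _ => c) q = 0 := by
  unfold MeroField.apply along
  rw [mfderiv_const]
  rfl

lemma MeroField.apply_negligible [T2Space X] (v : MeroField X) {f : X → ℂ} {p : X}
    (hf : ∀ᶠ q in 𝓝[≠] p, f q = 0) : ∀ᶠ q in 𝓝[≠] p, v.apply f q = 0 := by
  have h := eventually_eventually_nhdsWithin.2 hf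
  filter_upwards [h, self_mem_nhdsWithin] with q hq hne
  have hq' : f =ᶠ[𝓝 q] fun _ => 0 := by
    rwa [isOpen_compl_singleton.nhdsWithin_eq hne] at hq
  rw [← v.apply_const 0 q]
  unfold MeroField.apply along
  rw [hq'.mfderiv_eq]
  rfl

lemma tendsto_chart (p : X) :
    Filter.Tendsto (chartAt ℂ p) (𝓝[≠] p) (𝓝[≠] (chartAt ℂ p p)) := by
  have h := mem_chart_source ℂ p
  refine tendsto_nhdsWithin_iff.2 ⟨((chartAt ℂ p).continuousAt h).mono_left nhdsWithin_le_nhds, ?_⟩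
  filter_upwards [nhdsWithin_le_nhds ((chartAt ℂ p).open_source.mem_nhds h),
    self_mem_nhdsWithin] with q hq hne
  intro he
  exact hne ((chartAt ℂ p).injOn hq h he)

lemma tendsto_chart_symm (p : X) :
    Filter.Tendsto (chartAt ℂ p).symm (𝓝[≠] (chartAt ℂ p p)) (𝓝[≠] p) := by
  have h := mem_chart_target ℂ p
  have hs := mem_chart_source ℂ p
  refine tendsto_nhdsWithin_iff.2 ⟨?_, ?_⟩
  · have := ((chartAt ℂ p).continuousAt_symm h)
    rw [ContinuousAt, (chartAt ℂ p).left_inv hs] at this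
    exact this.mono_left nhdsWithin_le_nhds
  filter_upwards [nhdsWithin_le_nhds ((chartAt ℂ p).open_target.mem_nhds h),
    self_mem_nhdsWithin] with q hq hne
  intro he
  apply hne
  rw [← (chartAt ℂ p).right_inv hq, he]
  rfl

variable [IsManifold 𝓘(ℂ, ℂ) ω X]

/-- Outside isolated points a meromorphic function is holomorphic, and its derivative can be
computed in a chart. -/
lemma eventually_mdifferentiable {f : X → ℂ} {p : X} (hf : MeroAt f p) :
    ∀ᶠ q in 𝓝[≠] p, MDifferentiableAt 𝓘(ℂ, ℂ) 𝓘(ℂ, ℂ) f q ∧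
      ∀ w : TangentSpace 𝓘(ℂ, ℂ) q, along f q w =
        deriv (fun w => f ((chartAt ℂ p).symm w)) (chartAt ℂ p q) *
          along (chartAt ℂ p) q w := by
  have h1 := (tendsto_chart p).eventually hf.eventually_analyticAt
  have h2 : ∀ᶠ q in 𝓝[≠] p, q ∈ (chartAt ℂ p).source :=
    nhdsWithin_le_nhds ((chartAt ℂ p).open_source.mem_nhds (mem_chart_source ℂ p))
  filter_upwards [h1, h2] with q hq hs
  have hc : MDifferentiableAt 𝓘(ℂ, ℂ) 𝓘(ℂ, ℂ) (chartAt ℂ p) q :=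
    mdifferentiableAt_atlas (I := 𝓘(ℂ, ℂ)) (chart_mem_atlas ℂ p) hs
  have hg : DifferentiableAt ℂ (fun w => f ((chartAt ℂ p).symm w)) (chartAt ℂ p q) :=
    hq.differentiableAt
  have he : f =ᶠ[𝓝 q] (fun w => f ((chartAt ℂ p).symm w)) ∘ (chartAt ℂ p) := by
    filter_upwards [(chartAt ℂ p).open_source.mem_nhds hs] with r hr
    simp [(chartAt ℂ p).left_inv hr]
  refine ⟨(hg.mdifferentiableAt.comp q hc).congr_of_eventuallyEq he, fun w => ?_⟩
  unfold along
  rw [he.mfderiv_eq, mfderiv_comp q hg.mdifferentiableAt hc, mfderiv_eq_fderiv]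
  exact (fderiv_eq_smul_deriv (f := fun w => f ((chartAt ℂ p).symm w))
    (mfderiv 𝓘(ℂ, ℂ) 𝓘(ℂ, ℂ) (chartAt ℂ p) q w : ℂ)).trans (mul_comm _ _)

lemma MeroField.meroAt_apply (v : MeroField X) {f : X → ℂ} {p : X} (hf : MeroAt f p) :
    MeroAt (v.apply f) p := by
  refine (hf.deriv.mul (v.mero p)).congr ?_
  have h2 : ∀ᶠ w in 𝓝[≠] (chartAt ℂ p p), w ∈ (chartAt ℂ p).target :=
    nhdsWithin_le_nhds ((chartAt ℂ p).open_target.mem_nhds (mem_chart_target ℂ p))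
  filter_upwards [(tendsto_chart_symm p).eventually (eventually_mdifferentiable hf), h2]
    with w hw ht
  have := hw.2 (v.toFun _)
  rw [(chartAt ℂ p).right_inv ht] at this
  exact this.symm

lemma MeroField.apply_add (v : MeroField X) {f g : X → ℂ} {p : X} (hf : MeroAt f p)
    (hg : MeroAt g p) : ∀ᶠ q in 𝓝[≠] p, v.apply (f + g) q = v.apply f q + v.apply g q := by
  filter_upwards [eventually_mdifferentiable hf, eventually_mdifferentiable hg] with q h1 h2
  unfold MeroField.apply along
  rw [mfderiv_add h1.1 h2.1]
  rfl

lemma MeroField.apply_mul (v : MeroField X) {f g : X → ℂ} {p : X} (hf : MeroAt f p)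
    (hg : MeroAt g p) :
    ∀ᶠ q in 𝓝[≠] p, v.apply (f * g) q = f q * v.apply g q + g q * v.apply f q := by
  filter_upwards [eventually_mdifferentiable hf, eventually_mdifferentiable hg] with q h1 h2
  unfold MeroField.apply along
  have := (h1.1.hasMFDerivAt.mul h2.1.hasMFDerivAt).mfderiv
  rw [this]
  rfl

variable [T2Space X]

/-- `v` as a `ℂ`-linear map on representatives. -/
def MeroField.preDerivation (v : MeroField X) (U : TopologicalSpace.Opens X) :
    preMero X U →ₗ[ℂ] Mero X U where
  toFun f := Mero.mk U ⟨v.apply f.1, fun p hp => v.meroAt_apply (f.2 p hp)⟩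
  map_add' f g := by
    rw [← map_add, Mero.mk_eq]
    exact fun p hp => v.apply_add (f.2 p hp) (g.2 p hp)
  map_smul' c f := by
    rw [RingHom.id_apply, ← map_smul, Mero.mk_eq]
    intro p hp
    have hc : MeroAt (fun _ : X => c) p := MeromorphicAt.const c _
    filter_upwards [v.apply_mul hc (f.2 p hp)] with q hq
    rw [v.apply_const, mul_zero, add_zero] at hq
    exact hq

/-- The derivation `f ↦ v(f)` of the `ℂ`-algebra `𝓜(U)` induced by a meromorphic tangent
field. -/
def MeroField.derivation (v : MeroField X) (U : TopologicalSpace.Opens X) :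
    Derivation ℂ (Mero X U) (Mero X U) :=
  Derivation.mk'
    (Submodule.liftQ ((negligible U).restrictScalars ℂ) (v.preDerivation U) (fun _ hf =>
      (Mero.mk_eq_zero U _).2 fun p hp => v.apply_negligible (hf p hp)) :
        Mero X U →ₗ[ℂ] Mero X U)
    (by
      intro a b
      obtain ⟨f, rfl⟩ := Mero.mk_surjective U a
      obtain ⟨g, rfl⟩ := Mero.mk_surjective U b
      rw [← map_mul]
      change v.preDerivation U (f * g) = Mero.mk U f * v.preDerivation U g +
        Mero.mk U g * v.preDerivation U f
      unfold MeroField.preDerivation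
      rw [LinearMap.coe_mk, AddHom.coe_mk, ← map_mul, ← map_mul, ← map_add, Mero.mk_eq]
      exact fun p hp => v.apply_mul (f.2 p hp) (g.2 p hp))

lemma MeroField.derivation_mk (v : MeroField X) (U : TopologicalSpace.Opens X)
    (f : preMero X U) : v.derivation U (Mero.mk U f) =
      Mero.mk U ⟨v.apply f.1, fun p hp => v.meroAt_apply (f.2 p hp)⟩ :=
  rfl

end Meromorphic

/-! ### Meromorphic connections -/

section Connections

variable {X : Type*} [TopologicalSpace X] [ChartedSpace ℂ X] [IsManifold 𝓘(ℂ, ℂ) ω X] [T2Space X]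

/-- A meromorphic connection on a meromorphic vector bundle, given on the `k`-module `E` of global
meromorphic sections, `k = 𝓜(X)`, by its covariant derivative along a fixed meromorphic tangent
field `v`. -/
structure Connection (v : MeroField X) (E : Type*) [AddCommGroup E] [Module (Mero X ⊤) E] where
  toFun : E →+ E
  leibniz : ∀ (f : Mero X ⊤) (V : E), toFun (f • V) = v.derivation ⊤ f • V + f • toFun V

variable {v : MeroField X} {E : Type*} [AddCommGroup E] [Module (Mero X ⊤) E]
  {L : Type*} [AddCommGroup L] [Module (Mero X ⊤) L]

/-- The additive map `l ⊗ V ↦ ∇' l ⊗ V + l ⊗ ∇ V`. -/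
def Connection.tensorMap (C' : Connection v L) (C : Connection v E) :
    L ⊗[Mero X ⊤] E →+ L ⊗[Mero X ⊤] E :=
  TensorProduct.liftAddHom
    (AddMonoidHom.mk' (fun l => AddMonoidHom.mk'
        (fun V => C'.toFun l ⊗ₜ[Mero X ⊤] V + l ⊗ₜ[Mero X ⊤] C.toFun V)
        (fun V W => by rw [map_add, TensorProduct.tmul_add, TensorProduct.tmul_add]; abel))
      (fun l m => by
        ext V
        change C'.toFun (l + m) ⊗ₜ[Mero X ⊤] V + (l + m) ⊗ₜ[Mero X ⊤] C.toFun V =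
          (C'.toFun l ⊗ₜ[Mero X ⊤] V + l ⊗ₜ[Mero X ⊤] C.toFun V) +
          (C'.toFun m ⊗ₜ[Mero X ⊤] V + m ⊗ₜ[Mero X ⊤] C.toFun V)
        rw [map_add, TensorProduct.add_tmul, TensorProduct.add_tmul]; abel))
    (fun f l V => by
      change C'.toFun (f • l) ⊗ₜ[Mero X ⊤] V + (f • l) ⊗ₜ[Mero X ⊤] C.toFun V =
        C'.toFun l ⊗ₜ[Mero X ⊤] (f • V) + l ⊗ₜ[Mero X ⊤] C.toFun (f • V)
      rw [C'.leibniz, C.leibniz, TensorProduct.add_tmul, TensorProduct.tmul_add,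
        TensorProduct.smul_tmul, TensorProduct.smul_tmul, TensorProduct.smul_tmul]
      abel)

lemma Connection.tensorMap_tmul (C' : Connection v L) (C : Connection v E) (l : L) (V : E) :
    C'.tensorMap C (l ⊗ₜ V) = C'.toFun l ⊗ₜ V + l ⊗ₜ C.toFun V :=
  rfl

/-- The tensor product connection, `l ⊗ V ↦ ∇' l ⊗ V + l ⊗ ∇ V`. -/
def Connection.tensor (C' : Connection v L) (C : Connection v E) :
    Connection v (L ⊗[Mero X ⊤] E) where
  toFun := C'.tensorMap C
  leibniz f x := by
    induction x with
    | zero => simp only [smul_zero, map_zero, add_zero]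
    | add x y hx hy => rw [smul_add, map_add, hx, hy, map_add, smul_add, smul_add]; abel
    | tmul l V =>
      rw [TensorProduct.smul_tmul', C'.tensorMap_tmul, C'.tensorMap_tmul, C'.leibniz,
        TensorProduct.add_tmul, smul_add, TensorProduct.smul_tmul', TensorProduct.smul_tmul',
        TensorProduct.smul_tmul']
      abel

variable {n : ℕ}

/-- The matrix `a` of a connection in the frame `e`, with `∇ e_j = - ∑ i, a i j • e_i`. -/
def Connection.matrix (C : Connection v E) (e : Module.Basis (Fin n) (Mero X ⊤) E) :
    Matrix (Fin n) (Fin n) (Mero X ⊤) :=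
  Matrix.of fun i j => - e.repr (C.toFun (e j)) i

/-- `y` is a full system of solutions over `U`: its columns are the coordinates in the frame `e` of
horizontal sections over `U`, i.e. `v (y i j) = ∑ l, a i l * y l j`, and `det y ≠ 0`. -/
def Connection.IsFullSystem (C : Connection v E) (e : Module.Basis (Fin n) (Mero X ⊤) E)
    (U : TopologicalSpace.Opens X) (y : Matrix (Fin n) (Fin n) (Mero X U)) : Prop :=
  y.map (v.derivation U) = (C.matrix e).map (restrict U) * y ∧ y.det ≠ 0

end Connections

/-! ### Gradings -/

section Gradings

/-- A grading from a family of projections. -/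
@[reducible]
def gradedAlgebraOfProj {B : Type*} [CommRing B] [Algebra ℂ B] (ℬ : ℕ → Submodule ℂ B)
    [SetLike.GradedMonoid ℬ] (π : ℕ → B →+ B)
    (h2 : ∀ d, ∀ b ∈ ℬ d, π d b = b) (h3 : ∀ i d, i ≠ d → ∀ b ∈ ℬ i, π d b = 0)
    (h4 : ∀ b, b ∈ ⨆ d, ℬ d) : GradedAlgebra ℬ :=
  have key (x : DirectSum ℕ fun i => ℬ i) (d : ℕ) :
      π d (DirectSum.coeAddMonoidHom ℬ x) = x d := by
    induction x using DirectSum.induction_on with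
    | zero => simp
    | add x y hx hy => simp [hx, hy]
    | of i b =>
      rw [DirectSum.coeAddMonoidHom_of]
      by_cases hid : i = d
      · subst hid
        rw [h2 i b b.2, DirectSum.of_eq_same]
      · rw [h3 i d hid b b.2, DirectSum.of_eq_of_ne _ _ _ (Ne.symm hid)]
        rfl
  have hI : DirectSum.IsInternal ℬ := by
    refine ⟨fun x y hxy => ?_, fun b => ?_⟩
    · refine DFinsupp.ext fun d => Subtype.ext ?_
      rw [← key x d, ← key y d, hxy]
    · have := h4 b
      rw [← DirectSum.range_coeLinearMap] at this
      obtain ⟨x, hx⟩ := this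
      exact ⟨x, hx⟩
  { toDecomposition := hI.chooseDecomposition }

/-- The degree `d` part of the quotient of a graded algebra by an ideal. -/
def quotientDeg {A : Type*} [CommRing A] [Algebra ℂ A] (𝒜 : ℕ → Submodule ℂ A) (I : Ideal A)
    (d : ℕ) : Submodule ℂ (A ⧸ I) :=
  (𝒜 d).map (Ideal.Quotient.mkₐ ℂ I).toLinearMap

instance {A : Type*} [CommRing A] [Algebra ℂ A] (𝒜 : ℕ → Submodule ℂ A) [GradedAlgebra 𝒜]
    (I : HomogeneousIdeal 𝒜) : GradedAlgebra (quotientDeg 𝒜 I.toIdeal) :=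
  have : SetLike.GradedMonoid (quotientDeg 𝒜 I.toIdeal) :=
    { one_mem := ⟨1, SetLike.GradedOne.one_mem, map_one (Ideal.Quotient.mk I.toIdeal)⟩
      mul_mem := by
        rintro i j _ _ ⟨a, ha, rfl⟩ ⟨b, hb, rfl⟩
        exact ⟨a * b, SetLike.GradedMul.mul_mem ha hb, map_mul (Ideal.Quotient.mk I.toIdeal) a b⟩ }
  gradedAlgebraOfProj (quotientDeg 𝒜 I.toIdeal)
    (fun d => QuotientAddGroup.map _ _ (GradedRing.proj 𝒜 d) fun a ha => I.isHomogeneous d ha)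
    (by
      rintro d _ ⟨a, ha, rfl⟩
      change Ideal.Quotient.mk _ (GradedRing.proj 𝒜 d a) = Ideal.Quotient.mk _ a
      rw [GradedRing.proj_apply, DirectSum.decompose_of_mem_same _ ha])
    (by
      rintro i d hid _ ⟨a, ha, rfl⟩
      change Ideal.Quotient.mk _ (GradedRing.proj 𝒜 d a) = 0
      rw [GradedRing.proj_apply, DirectSum.decompose_of_mem_ne _ ha hid, map_zero])
    (by
      classical
      intro b
      obtain ⟨a, rfl⟩ := Ideal.Quotient.mk_surjective b
      rw [← DirectSum.sum_support_decompose 𝒜 a, map_sum]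
      exact Submodule.sum_mem _ fun i _ => Submodule.mem_iSup_of_mem i
        ⟨_, SetLike.coe_mem _, rfl⟩)

end Gradings

/-! ### The Galois group and its invariants -/

section Galois

variable {n : ℕ}

/-- The substitution `X i j ↦ ∑ l, X i l * g l j` on polynomials in the entries of an `n × n`
matrix. -/
def translate (R : Type*) [CommRing R] [Algebra ℂ R] (g : Matrix (Fin n) (Fin n) ℂ) :
    MvPolynomial (Fin n × Fin n) R →ₐ[R] MvPolynomial (Fin n × Fin n) R :=
  MvPolynomial.aeval fun ij => ∑ l, MvPolynomial.X (ij.1, l) *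
    MvPolynomial.C (algebraMap ℂ R (g l ij.2))

lemma translate_mul (R : Type*) [CommRing R] [Algebra ℂ R] (g h : Matrix (Fin n) (Fin n) ℂ)
    (P : MvPolynomial (Fin n × Fin n) R) :
    translate R (g * h) P = translate R g (translate R h P) := by
  have : translate R (g * h) = (translate R g).comp (translate R h) := by
    refine MvPolynomial.algHom_ext fun ij => ?_
    simp only [translate, MvPolynomial.aeval_X, AlgHom.comp_apply, map_sum, map_mul,
      Matrix.mul_apply, MvPolynomial.algHom_C, MvPolynomial.algebraMap_eq, Finset.mul_sum,
      Finset.sum_mul]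
    rw [Finset.sum_comm]
    simp only [mul_assoc]
  rw [this, AlgHom.comp_apply]

lemma translate_one (R : Type*) [CommRing R] [Algebra ℂ R]
    (P : MvPolynomial (Fin n × Fin n) R) : translate R (1 : Matrix (Fin n) (Fin n) ℂ) P = P := by
  have : translate R (1 : Matrix (Fin n) (Fin n) ℂ) = AlgHom.id R _ := by
    refine MvPolynomial.algHom_ext fun ij => ?_
    simp [translate, Matrix.one_apply, apply_ite]
  rw [this]; rfl

section

variable {X : Type*} [TopologicalSpace X] [ChartedSpace ℂ X]

/-- The ideal of polynomial relations with coefficients in `k = 𝓜(X)` between the entries of `y`,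
i.e. the kernel of `k[X i j] → 𝓜(U)`, `X i j ↦ y i j`. -/
def relations {U : TopologicalSpace.Opens X} (y : Matrix (Fin n) (Fin n) (Mero X U)) :
    Ideal (MvPolynomial (Fin n × Fin n) (Mero X ⊤)) :=
  RingHom.ker (MvPolynomial.eval₂Hom (restrict U).toRingHom fun ij => y ij.1 ij.2)

/-- The Galois group attached to a full system of solutions `y`: the matrices `g` for which
`X i j ↦ ∑ l, X i l * g l j` sends the ideal of relations of `y` to itself. (As `det` is
multiplied by a nonzero constant, it makes no difference whether `det` is inverted.) -/
def galoisGroup {U : TopologicalSpace.Opens X} (y : Matrix (Fin n) (Fin n) (Mero X U)) :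
    Subgroup (Matrix.GeneralLinearGroup (Fin n) ℂ) where
  carrier := {g | ∀ P, P ∈ relations y ↔ translate (Mero X ⊤) g.1 P ∈ relations y}
  one_mem' P := by rw [Units.val_one, translate_one]
  mul_mem' {g h} hg hh P := by rw [hh, hg, Units.val_mul, translate_mul]
  inv_mem' {g} hg P := by
    rw [hg (translate _ _ P), ← translate_mul, ← Units.val_mul, mul_inv_cancel, Units.val_one,
      translate_one]

end

/-- `G` is unimodular, i.e. contained in the special linear group. -/
def IsUnimodular (G : Subgroup (Matrix.GeneralLinearGroup (Fin n) ℂ)) : Prop :=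
  ∀ g ∈ G, (g : Matrix (Fin n) (Fin n) ℂ).det = 1

/-- `N` is closed in `GL_n(ℂ)` for the Zariski topology. -/
def IsZariskiClosed (N : Subgroup (Matrix.GeneralLinearGroup (Fin n) ℂ)) : Prop :=
  ∃ S : Set (MvPolynomial (Fin n × Fin n) ℂ), ∀ g, g ∈ N ↔
    ∀ P ∈ S, MvPolynomial.eval (fun ij => (g : Matrix (Fin n) (Fin n) ℂ) ij.1 ij.2) P = 0

/-- The algebraic group `G` is reductive: its unipotent radical is trivial, i.e. it has no
nontrivial closed normal subgroup consisting of unipotent matrices. (In characteristic zero closed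
unipotent groups are connected.) -/
def IsReductive (G : Subgroup (Matrix.GeneralLinearGroup (Fin n) ℂ)) : Prop :=
  ∀ N ≤ G, IsZariskiClosed N → (∀ g ∈ G, ∀ h ∈ N, g * h * g⁻¹ ∈ N) →
    (∀ h ∈ N, IsNilpotent ((h : Matrix (Fin n) (Fin n) ℂ) - 1)) → N = ⊥

/-- The algebra of `G`-invariants in `ℂ[X i j]`. -/
def invariants (G : Subgroup (Matrix.GeneralLinearGroup (Fin n) ℂ)) :
    Subalgebra ℂ (MvPolynomial (Fin n × Fin n) ℂ) where
  carrier := {P | ∀ g ∈ G, translate ℂ g.1 P = P}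
  mul_mem' hP hQ g hg := by rw [map_mul, hP g hg, hQ g hg]
  add_mem' hP hQ g hg := by rw [map_add, hP g hg, hQ g hg]
  algebraMap_mem' c g _ := by rw [MvPolynomial.algebraMap_eq, MvPolynomial.algHom_C]; rfl

/-- The invariants that are homogeneous of degree `d`. -/
def invariantsDeg (G : Subgroup (Matrix.GeneralLinearGroup (Fin n) ℂ)) (d : ℕ) :
    Submodule ℂ (invariants G) :=
  (MvPolynomial.homogeneousSubmodule (Fin n × Fin n) ℂ d).comap (invariants G).val.toLinearMap

/-- Translation preserves degrees. -/
lemma translate_isHomogeneous (g : Matrix (Fin n) (Fin n) ℂ)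
    {P : MvPolynomial (Fin n × Fin n) ℂ} {d : ℕ} (hP : P.IsHomogeneous d) :
    (translate ℂ g P).IsHomogeneous d := by
  have := hP.aeval (fun ij : Fin n × Fin n => ∑ l, MvPolynomial.X (ij.1, l) *
    MvPolynomial.C (σ := Fin n × Fin n) (algebraMap ℂ ℂ (g l ij.2))) (n := 1) (fun ij =>
      MvPolynomial.IsHomogeneous.sum _ _ _ fun l _ =>
        (MvPolynomial.isHomogeneous_X ℂ (ij.1, l)).mul (MvPolynomial.isHomogeneous_C _ _))
  rw [one_mul] at this
  exact this

lemma translate_homogeneousComponent (g : Matrix (Fin n) (Fin n) ℂ) (d : ℕ)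
    (P : MvPolynomial (Fin n × Fin n) ℂ) :
    translate ℂ g (MvPolynomial.homogeneousComponent d P) =
      MvPolynomial.homogeneousComponent d (translate ℂ g P) := by
  conv_rhs => rw [← MvPolynomial.sum_homogeneousComponent P, map_sum, map_sum]
  have h (i : ℕ) : MvPolynomial.homogeneousComponent d
      (translate ℂ g (MvPolynomial.homogeneousComponent i P)) =
      if i = d then translate ℂ g (MvPolynomial.homogeneousComponent i P) else 0 := by
    rw [MvPolynomial.homogeneousComponent_of_mem (translate_isHomogeneous g
      (MvPolynomial.homogeneousComponent_isHomogeneous i P))]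
    simp [eq_comm]
  simp only [h, Finset.sum_ite_eq', Finset.mem_range]
  split_ifs with hd
  · rfl
  · rw [MvPolynomial.homogeneousComponent_eq_zero _ _ (by omega), map_zero]

instance (G : Subgroup (Matrix.GeneralLinearGroup (Fin n) ℂ)) :
    GradedAlgebra (invariantsDeg G) :=
  have : SetLike.GradedMonoid (invariantsDeg G) :=
    { one_mem := MvPolynomial.isHomogeneous_one _ _
      mul_mem := fun _ _ _ _ hP hQ => MvPolynomial.IsHomogeneous.mul hP hQ }
  gradedAlgebraOfProj (invariantsDeg G)
    (fun d => AddMonoidHom.mk'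
      (fun P => ⟨MvPolynomial.homogeneousComponent d P.1, fun g hg => by
        rw [translate_homogeneousComponent, P.2 g hg]⟩)
      (fun P Q => Subtype.ext (map_add _ _ _)))
    (fun d P hP => Subtype.ext (MvPolynomial.homogeneousComponent_eq_self hP))
    (fun i d hid P hP => Subtype.ext (by
      change MvPolynomial.homogeneousComponent d P.1 = 0
      rw [MvPolynomial.homogeneousComponent_of_mem (show P.1 ∈ MvPolynomial.homogeneousSubmodule _ _ i from hP),
        if_neg hid.symm]))
    (fun P => by
      have h : P = ∑ i ∈ Finset.range (P.1.totalDegree + 1),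
          (⟨MvPolynomial.homogeneousComponent i P.1, fun g hg => by
            rw [translate_homogeneousComponent, P.2 g hg]⟩ : invariants G) := by
        apply Subtype.ext
        rw [AddSubmonoidClass.coe_finsetSum]
        exact (MvPolynomial.sum_homogeneousComponent P.1).symm
      rw [h]
      exact Submodule.sum_mem _ fun i _ => Submodule.mem_iSup_of_mem i
        (MvPolynomial.homogeneousComponent_isHomogeneous i P.1))

end Galois

/-! ### The projective Fano curve -/

section Proj

open AlgebraicGeometry CategoryTheory

/-- The projective scheme over `ℂ` defined by a homogeneous ideal, `Z(I) = Proj (A ⧸ I)`. -/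
def projOf {A : Type} [CommRing A] [Algebra ℂ A] (𝒜 : ℕ → Submodule ℂ A) [GradedAlgebra 𝒜]
    (I : HomogeneousIdeal 𝒜) : Scheme.{0} :=
  AlgebraicGeometry.Proj (quotientDeg 𝒜 I.toIdeal)

instance {A : Type} [CommRing A] [Algebra ℂ A] (𝒜 : ℕ → Submodule ℂ A) [GradedAlgebra 𝒜]
    (I : HomogeneousIdeal 𝒜) : (projOf 𝒜 I).IsSeparated :=
  inferInstanceAs (AlgebraicGeometry.Proj (quotientDeg 𝒜 I.toIdeal)).IsSeparated

/-- The structure morphism to `Spec ℂ`. -/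
def projOfStr {A : Type} [CommRing A] [Algebra ℂ A] (𝒜 : ℕ → Submodule ℂ A) [GradedAlgebra 𝒜]
    (I : HomogeneousIdeal 𝒜) : projOf 𝒜 I ⟶ Spec (CommRingCat.of ℂ) :=
  Proj.toSpecZero (quotientDeg 𝒜 I.toIdeal) ≫
    Spec.map (CommRingCat.ofHom (algebraMap ℂ (quotientDeg 𝒜 I.toIdeal 0)))

/-- The inclusion of the generic point of an integral scheme. -/
def genericInclusion (Z : Scheme.{0}) [IsIntegral Z] : Spec Z.functionField ⟶ Z :=
  Z.fromSpecStalk (genericPoint Z)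

instance (Z : Scheme.{0}) [IsIntegral Z] [Z.IsSeparated] : QuasiCompact (genericInclusion Z) :=
  inferInstance

instance (Z : Scheme.{0}) [IsIntegral Z] : QuasiSeparated (genericInclusion Z) :=
  inferInstanceAs (QuasiSeparated (Z.fromSpecStalk (genericPoint Z)))

/-- The normalization of `Z`, i.e. the integral closure of `Z` in its function field. When `Z` is a
projective curve (or a point) this is its non-singular model. -/
def nonsingularModel (Z : Scheme.{0}) [IsIntegral Z] [Z.IsSeparated] : Scheme.{0} :=
  (genericInclusion Z).normalization

/-- The birational morphism from the non-singular model. -/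
def nonsingularModelMap (Z : Scheme.{0}) [IsIntegral Z] [Z.IsSeparated] : nonsingularModel Z ⟶ Z :=
  (genericInclusion Z).fromNormalization

end Proj

section Fano

open AlgebraicGeometry CategoryTheory

variable {n : ℕ} {X : Type*} [TopologicalSpace X] [ChartedSpace ℂ X]
  {U : TopologicalSpace.Opens X}

/-- The evaluation `P ↦ P(y)` on the invariants of the Galois group. -/
def evalInvariants (y : Matrix (Fin n) (Fin n) (Mero X U)) :
    invariants (galoisGroup y) →ₐ[ℂ] Mero X U :=
  (MvPolynomial.aeval fun ij => y ij.1 ij.2).comp (invariants (galoisGroup y)).val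

/-- The largest homogeneous ideal `J` contained in the kernel of `P ↦ P(y)`. -/
def fanoIdeal (y : Matrix (Fin n) (Fin n) (Mero X U)) :
    HomogeneousIdeal (invariantsDeg (galoisGroup y)) :=
  Ideal.homogeneousCore _ (RingHom.ker (evalInvariants y))

/-- The projective variety `Z(J) ⊆ Proj (ℂ[X i j]^G)`; its non-singular model is the projective Fano
curve. -/
abbrev fanoVariety (y : Matrix (Fin n) (Fin n) (Mero X U)) : Scheme.{0} :=
  projOf (invariantsDeg (galoisGroup y)) (fanoIdeal y)

/-- The structure morphism of `Z(J)` over `ℂ`. -/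
abbrev fanoVarietyStr (y : Matrix (Fin n) (Fin n) (Mero X U)) :
    fanoVariety y ⟶ Spec (CommRingCat.of ℂ) :=
  projOfStr (invariantsDeg (galoisGroup y)) (fanoIdeal y)

/-- The projective Fano curve `X₀`, the non-singular model of `Z(J)`. -/
abbrev fanoCurve (y : Matrix (Fin n) (Fin n) (Mero X U)) [IsIntegral (fanoVariety y)] :
    Scheme.{0} :=
  nonsingularModel (fanoVariety y)

/-- The birational morphism from the projective Fano curve to `Z(J)`. -/
abbrev fanoCurveMap (y : Matrix (Fin n) (Fin n) (Mero X U)) [IsIntegral (fanoVariety y)] :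
    fanoCurve y ⟶ fanoVariety y :=
  nonsingularModelMap (fanoVariety y)

/-- The function field of the projective Fano curve as a subset of `𝓜(U)`: the quotients
`P(y) / Q(y)` with `P`, `Q` homogeneous invariants of the same degree and `Q(y) ≠ 0`. -/
def fanoFunctions (y : Matrix (Fin n) (Fin n) (Mero X U)) : Set (Mero X U) :=
  {r | ∃ (d : ℕ) (P Q : invariants (galoisGroup y)), P ∈ invariantsDeg (galoisGroup y) d ∧
    Q ∈ invariantsDeg (galoisGroup y) d ∧ evalInvariants y Q ≠ 0 ∧
    r * evalInvariants y Q = evalInvariants y P}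

end Fano

end FanoCurve

end

noncomputable section

namespace FanoCurve

/-! ### The field of meromorphic functions -/

section MeroField

variable {X : Type*} [TopologicalSpace X] [ChartedSpace ℂ X]

/-! Write `k` for `𝓜(X)`, `K` for `𝓜(U)`, `G` and `G₁` for the Galois groups of `y` and `y₁`. The
matrices of the two connections differ by a scalar matrix `b`, so `M = y⁻¹ y₁` satisfies `v(M) = b
M` entrywise. Ratios of entries of `M` are killed by `v`, hence are complex numbers, and therefore
`y₁ = t y c` with `t ∈ K` nonzero and `c ∈ GL_n(ℂ)` (`exists_eq_smul_mul`).

Unimodularity forces `det y` and `det y₁` into `k` (`det_mem_range`), whence `t ^ n ∈ k`. This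
fragment of Picard-Vessiot theory is obtained by hand: the relations between the entries of `y` give
a differential ideal in the coordinates of a generic matrix. Such an ideal is generated by
polynomials with constant coefficients, the Nullstellensatz over `ℂ` applies to these, and the
outcome is evaluated at the matrix `(y⁻¹ ⊗ 1)(1 ⊗ y)` over `K ⊗ K`.

As `t ^ n` is rational, multiplication by `t` affects relations over `k` only through degrees modulo
`n`. Consequently `c g c⁻¹`, for `g ∈ G₁`, is an element of `G` up to an `n`-th root of unity, and
symmetrically (`PreservesRelations.exists_rootOfUnity`). Roots of unity act trivially in degrees
divisible by `n`, so in these degrees `X ↦ X c` identifies the invariants of `G₁` with those of `G`;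
the factor `t` does not affect the vanishing of homogeneous polynomials.

Both `Proj` and the field of quotients of degree zero depend only on the degrees divisible by `n`
(`veroneseIso`, `fanoFunctions_subset`), and isomorphisms of integral schemes lift to normalizations
(`exists_iso_nonsingularModel`). Integrality holds because the homogeneous core of a prime ideal is
prime and `det` is a homogeneous invariant of positive degree that does not vanish at a full system
(`isIntegral_projOf_relIdeal`). -/

lemma nhdsNE_neBot (p : X) : (𝓝[≠] p).NeBot :=
  (Filter.NeBot.map (inferInstanceAs (𝓝[≠] (chartAt ℂ p p)).NeBot) _).mono (tendsto_chart_symm p)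

lemma MeroAt.eventually_eq_zero_or_ne_zero {f : X → ℂ} {p : X} (hf : MeroAt f p) :
    (∀ᶠ q in 𝓝[≠] p, f q = 0) ∨ ∀ᶠ q in 𝓝[≠] p, f q ≠ 0 := by
  have hs : ∀ᶠ q in 𝓝[≠] p, q ∈ (chartAt ℂ p).source :=
    nhdsWithin_le_nhds ((chartAt ℂ p).open_source.mem_nhds (mem_chart_source ℂ p))
  rcases MeromorphicAt.eventually_eq_zero_or_eventually_ne_zero hf with h | h
  · left
    filter_upwards [(tendsto_chart p).eventually h, hs] with q hq hqs
    rwa [(chartAt ℂ p).left_inv hqs] at hq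
  · right
    filter_upwards [(tendsto_chart p).eventually h, hs] with q hq hqs
    rwa [(chartAt ℂ p).left_inv hqs] at hq

/-- The identity theorem. -/
lemma eventually_eq_zero_of_isPreconnected [T1Space X] {f : X → ℂ} {s : Set X}
    (hs : IsPreconnected s) (hf : ∀ p ∈ s, MeroAt f p) {p : X} (hp : p ∈ s)
    (h : ∃ᶠ q in 𝓝[≠] p, f q = 0) : ∀ q ∈ s, ∀ᶠ r in 𝓝[≠] q, f r = 0 := by
  have key : s ⊆ {q | ∀ᶠ r in 𝓝[≠] q, f r = 0} := by
    refine hs.subset_left_of_subset_union (v := {q | ∀ᶠ r in 𝓝[≠] q, f r ≠ 0})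
      isOpen_setOfPred_eventually_nhdsWithin isOpen_setOfPred_eventually_nhdsWithin ?_ ?_
      ⟨p, hp, ((hf p hp).eventually_eq_zero_or_ne_zero).resolve_right h⟩
    · refine Set.disjoint_left.2 fun q (h1 : ∀ᶠ r in 𝓝[≠] q, f r = 0)
        (h2 : ∀ᶠ r in 𝓝[≠] q, f r ≠ 0) => ?_
      have := nhdsNE_neBot q
      obtain ⟨r, hr, hr'⟩ := (h1.and h2).exists
      exact hr' hr
    · exact fun q hq => (hf q hq).eventually_eq_zero_or_ne_zero
  exact fun q hq => key hq

lemma along_chart_ne_zero [IsManifold 𝓘(ℂ, ℂ) ω X] {p q : X} (hq : q ∈ (chartAt ℂ p).source)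
    {w : TangentSpace 𝓘(ℂ, ℂ) q} (hw : w ≠ 0) : along (chartAt ℂ p) q w ≠ 0 := by
  intro h
  have hi : (mfderiv 𝓘(ℂ, ℂ) 𝓘(ℂ, ℂ) (extChartAt 𝓘(ℂ, ℂ) p) q).IsInvertible :=
    isInvertible_mfderiv_extChartAt (by simpa using hq)
  have he : ⇑(extChartAt 𝓘(ℂ, ℂ) p) = chartAt ℂ p := by ext; simp
  rw [he] at hi
  exact hw (hi.injective (h.trans (map_zero _).symm))

variable [T2Space X] {U : TopologicalSpace.Opens X}

/-- By the identity theorem a non-negligible function on a connected `U` has only isolated zeros, so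
its pointwise inverse is an inverse in `𝓜(U)`. -/
lemma Mero.isField (hU : IsConnected (U : Set X)) : IsField (Mero X U) where
  exists_pair_ne := by
    refine ⟨1, 0, fun h => ?_⟩
    obtain ⟨p, hp⟩ := hU.nonempty
    rw [← map_one (Mero.mk U), Mero.mk_eq_zero] at h
    have := nhdsNE_neBot p
    obtain ⟨q, hq⟩ := (h p hp).exists
    exact one_ne_zero hq
  mul_comm := mul_comm
  mul_inv_cancel := by
    intro a ha
    obtain ⟨f, rfl⟩ := Mero.mk_surjective U a
    refine ⟨Mero.mk U ⟨f.1⁻¹, fun p hp => (f.2 p hp).inv⟩, ?_⟩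
    rw [← map_mul, ← map_one (Mero.mk U), Mero.mk_eq]
    intro p hp
    have h : ∀ᶠ q in 𝓝[≠] p, f.1 q ≠ 0 := by
      by_contra h
      refine ha ((Mero.mk_eq_zero U f).2
        (eventually_eq_zero_of_isPreconnected hU.isPreconnected f.2 hp ?_))
      exact h
    filter_upwards [h] with q hq
    exact mul_inv_cancel₀ hq

/-- The field structure of `𝓜(U)`, for connected `U`. -/
@[reducible]
def Mero.field (hU : IsConnected (U : Set X)) : Field (Mero X U) :=
  (Mero.isField hU).toField

variable [IsManifold 𝓘(ℂ, ℂ) ω X]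

lemma MeroField.derivation_restrict (v : MeroField X) (a : Mero X ⊤) :
    v.derivation U (restrict U a) = restrict U (v.derivation ⊤ a) := by
  obtain ⟨f, rfl⟩ := Mero.mk_surjective _ a
  rfl

variable [ConnectedSpace X]

/-- The identity theorem for tangent fields: in a chart the coefficient of `v` is meromorphic, so
the dichotomy for meromorphic functions and the connectedness of `X` apply. -/
lemma MeroField.IsNonzero.eventually_ne_zero {v : MeroField X} (hv : v.IsNonzero) (p : X) :
    ∀ᶠ q in 𝓝[≠] p, v.toFun q ≠ 0 := by
  have dich (p : X) : (∀ᶠ q in 𝓝[≠] p, v.toFun q = 0) ∨ ∀ᶠ q in 𝓝[≠] p, v.toFun q ≠ 0 := by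
    have hs : ∀ᶠ q in 𝓝[≠] p, q ∈ (chartAt ℂ p).source :=
      nhdsWithin_le_nhds ((chartAt ℂ p).open_source.mem_nhds (mem_chart_source ℂ p))
    rcases (v.mero p).eventually_eq_zero_or_eventually_ne_zero with h | h
    · left
      filter_upwards [(tendsto_chart p).eventually h, hs] with q hq hqs
      rw [(chartAt ℂ p).left_inv hqs] at hq
      by_contra hne
      exact along_chart_ne_zero hqs hne hq
    · right
      filter_upwards [(tendsto_chart p).eventually h, hs] with q hq hqs h0
      rw [(chartAt ℂ p).left_inv hqs] at hq
      apply hq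
      rw [h0]
      exact map_zero (mfderiv 𝓘(ℂ, ℂ) 𝓘(ℂ, ℂ) (chartAt ℂ p) q)
  refine (dich p).resolve_left fun h0 => hv ?_
  have key : Set.univ ⊆ {q | ∀ᶠ r in 𝓝[≠] q, v.toFun r = 0} := by
    refine isPreconnected_univ.subset_left_of_subset_union
      (v := {q | ∀ᶠ r in 𝓝[≠] q, v.toFun r ≠ 0})
      isOpen_setOfPred_eventually_nhdsWithin isOpen_setOfPred_eventually_nhdsWithin ?_ ?_
      ⟨p, trivial, h0⟩
    · refine Set.disjoint_left.2 fun q (h1 : ∀ᶠ r in 𝓝[≠] q, v.toFun r = 0)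
        (h2 : ∀ᶠ r in 𝓝[≠] q, v.toFun r ≠ 0) => ?_
      have := nhdsNE_neBot q
      obtain ⟨r, hr, hr'⟩ := (h1.and h2).exists
      exact hr' hr
    · exact fun q _ => dich q
  exact fun q => key (Set.mem_univ q)

/-- The constants of the differential field `𝓜(U)` are the complex numbers. -/
lemma MeroField.mem_range_of_derivation_eq_zero {v : MeroField X} (hv : v.IsNonzero)
    (hU : IsConnected (U : Set X)) {a : Mero X U} (ha : v.derivation U a = 0) :
    a ∈ (algebraMap ℂ (Mero X U)).range := by
  obtain ⟨f, rfl⟩ := Mero.mk_surjective U a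
  rw [v.derivation_mk, Mero.mk_eq_zero] at ha
  obtain ⟨p, hp⟩ := hU.nonempty
  have hp' : ∀ᶠ q in 𝓝[≠] p, q ∈ U := nhdsWithin_le_nhds (U.isOpen.mem_nhds hp)
  have hs : ∀ᶠ q in 𝓝[≠] p, q ∈ (chartAt ℂ p).source :=
    nhdsWithin_le_nhds ((chartAt ℂ p).open_source.mem_nhds (mem_chart_source ℂ p))
  have hderiv : ∀ᶠ q in 𝓝[≠] p,
      deriv (fun w => f.1 ((chartAt ℂ p).symm w)) (chartAt ℂ p q) = 0 := by
    filter_upwards [ha p hp, eventually_mdifferentiable (f.2 p hp), hs,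
      hv.eventually_ne_zero p] with q h1 h2 h3 h4
    have := h2.2 (v.toFun q)
    exact (mul_eq_zero.1 (this.symm.trans h1)).resolve_right (along_chart_ne_zero h3 h4)
  have hz : ∀ᶠ w in 𝓝[≠] (chartAt ℂ p p),
      deriv (fun w => f.1 ((chartAt ℂ p).symm w)) w = 0 := by
    have ht : ∀ᶠ w in 𝓝[≠] (chartAt ℂ p p), w ∈ (chartAt ℂ p).target :=
      nhdsWithin_le_nhds ((chartAt ℂ p).open_target.mem_nhds (mem_chart_target ℂ p))
    filter_upwards [(tendsto_chart_symm p).eventually hderiv, ht] with w h1 h2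
    rwa [(chartAt ℂ p).right_inv h2] at h1
  have hz' := eventually_eventually_nhdsWithin.2 hz
  have := nhdsNE_neBot p
  -- The point `p` may be a pole, so the argument moves to a nearby `q ≠ p` around which `f` is
  -- holomorphic with zero derivative. It is constant there, and the identity theorem started at `q`
  -- spreads this over `U`.
  obtain ⟨q, ⟨⟨⟨hqz, hqa⟩, hqU⟩, hqs⟩, hqp⟩ :=
    (((((tendsto_chart p).eventually hz').and
      ((tendsto_chart p).eventually (f.2 p hp).eventually_analyticAt)).and hp').and hs).and
      ((tendsto_chart p).eventually self_mem_nhdsWithin) |>.exists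
  rw [isOpen_compl_singleton.nhdsWithin_eq hqp] at hqz
  obtain ⟨ε, hε, hball⟩ := Metric.eventually_nhds_iff_ball.1
    (hqz.and hqa.eventually_analyticAt)
  set F := fun w => f.1 ((chartAt ℂ p).symm w) with hF
  have hconst : ∀ w ∈ Metric.ball (chartAt ℂ p q) ε, F w = F (chartAt ℂ p q) := by
    intro w hw
    refine (convex_ball _ _).is_const_of_fderivWithin_eq_zero (𝕜 := ℂ) (f := F)
      (fun z hz => (hball z hz).2.differentiableAt.differentiableWithinAt) (fun z hz => ?_) hw
      (Metric.mem_ball_self hε)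
    rw [fderivWithin_of_isOpen Metric.isOpen_ball hz]
    ext
    simpa using (hball z hz).1
  refine ⟨F (chartAt ℂ p q), ?_⟩
  change algebraMap ℂ (Mero X U) _ = _
  rw [← AlgHom.commutes (Mero.mk U), ← sub_eq_zero, ← map_sub, Mero.mk_eq_zero]
  refine eventually_eq_zero_of_isPreconnected hU.isPreconnected
    (algebraMap ℂ (preMero X U) (F (chartAt ℂ p q)) - f).2 hqU ?_
  have hev : ∀ᶠ r in 𝓝 q, chartAt ℂ p r ∈ Metric.ball (chartAt ℂ p q) ε :=
    ((chartAt ℂ p).continuousAt hqs).eventually (Metric.ball_mem_nhds _ hε)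
  have := nhdsNE_neBot q
  refine Filter.Eventually.frequently ?_
  filter_upwards [nhdsWithin_le_nhds hev,
    nhdsWithin_le_nhds ((chartAt ℂ p).open_source.mem_nhds hqs)] with r hr hrs
  have h1 := hconst _ hr
  simp only [hF, (chartAt ℂ p).left_inv hrs] at h1
  change F (chartAt ℂ p q) - f.1 r = 0
  rw [h1, hF]
  simp

end MeroField

/-! ### Linear differential systems and unimodularity -/

section DifferentialAlgebra

section Coefficients

variable {C K σ : Type*} [CommRing C] [CommRing K] [Algebra C K]

/-- The extension of a derivation of `K` to `K[σ]` that kills the variables. -/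
def coeffDeriv (D : Derivation C K K) (f : MvPolynomial σ K) : MvPolynomial σ K :=
  ∑ m ∈ f.support, MvPolynomial.monomial m (D (f.coeff m))

@[simp]
lemma coeff_coeffDeriv (D : Derivation C K K) (f : MvPolynomial σ K) (m : σ →₀ ℕ) :
    (coeffDeriv D f).coeff m = D (f.coeff m) := by
  classical
  simp only [coeffDeriv, MvPolynomial.coeff_sum, MvPolynomial.coeff_monomial]
  rw [Finset.sum_ite_eq']
  split_ifs with h
  · rfl
  · rw [MvPolynomial.notMem_support_iff.1 h, map_zero]

lemma coeffDeriv_add (D : Derivation C K K) (f g : MvPolynomial σ K) :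
    coeffDeriv D (f + g) = coeffDeriv D f + coeffDeriv D g := by
  ext m; simp

lemma coeffDeriv_mul (D : Derivation C K K) (f g : MvPolynomial σ K) :
    coeffDeriv D (f * g) = f * coeffDeriv D g + g * coeffDeriv D f := by
  classical
  ext m
  rw [mul_comm g]
  simp only [coeff_coeffDeriv, MvPolynomial.coeff_add, MvPolynomial.coeff_mul, map_sum,
    Derivation.leibniz, smul_eq_mul, Finset.sum_add_distrib]
  congr 1
  exact Finset.sum_congr rfl fun i _ => mul_comm _ _

lemma coeffDeriv_C (D : Derivation C K K) (x : K) :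
    coeffDeriv D (MvPolynomial.C x : MvPolynomial σ K) = MvPolynomial.C (D x) := by
  classical
  ext m
  simp only [coeff_coeffDeriv, MvPolynomial.coeff_C]
  split_ifs <;> simp

lemma coeffDeriv_X (D : Derivation C K K) (i : σ) :
    coeffDeriv D (MvPolynomial.X i : MvPolynomial σ K) = 0 := by
  classical
  ext m
  simp only [coeff_coeffDeriv, MvPolynomial.coeff_X, MvPolynomial.coeff_zero]
  split_ifs <;> simp

lemma coeffDeriv_sum (D : Derivation C K K) {ι : Type*} (s : Finset ι)
    (f : ι → MvPolynomial σ K) :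
    coeffDeriv D (∑ i ∈ s, f i) = ∑ i ∈ s, coeffDeriv D (f i) := by
  ext m; simp [MvPolynomial.coeff_sum]

end Coefficients

/-- A differential subspace of `K[σ]` is spanned by polynomials with constant coefficients. -/
lemma mem_span_constants {C K σ : Type*} [CommRing C] [Field K] [Algebra C K]
    (D : Derivation C K K) (hD : ∀ x, D x = 0 → x ∈ (algebraMap C K).range)
    (V : Submodule K (MvPolynomial σ K)) (hV : ∀ f ∈ V, coeffDeriv D f ∈ V)
    {f : MvPolynomial σ K} (hf : f ∈ V) :
    f ∈ Submodule.span K {g | g ∈ V ∧ g ∈ Set.range (MvPolynomial.map (algebraMap C K))} := by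
  classical
  induction hk : f.support.card using Nat.strong_induction_on generalizing f with
  | _ k ih =>
  by_cases hf0 : f = 0
  · rw [hf0]; exact zero_mem _
  -- Minimal support: once a coefficient of `g` is scaled to `1`, the derivative loses that
  -- monomial, so it vanishes by minimality and all coefficients are constants. Subtracting a
  -- multiple of this element shrinks the support of `f`.
  obtain ⟨g, ⟨hgV, hg0, hgs⟩, hmin⟩ :=
    (measure fun g : MvPolynomial σ K => g.support.card).wf.has_min
      {g | g ∈ V ∧ g ≠ 0 ∧ g.support ⊆ f.support} ⟨f, hf, hf0, subset_rfl⟩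
  obtain ⟨m, hm⟩ := MvPolynomial.support_nonempty.2 hg0
  have hm0 : g.coeff m ≠ 0 := MvPolynomial.mem_support_iff.1 hm
  set h := (g.coeff m)⁻¹ • g with hh
  have hhm : h.coeff m = 1 := by simp [hh, hm0]
  have hhV : h ∈ V := V.smul_mem _ hgV
  have hhs : h.support ⊆ g.support := MvPolynomial.support_smul
  have hdh : coeffDeriv D h = 0 := by
    by_contra hne
    have hsub : (coeffDeriv D h).support ⊆ g.support.erase m := by
      intro i hi
      rw [MvPolynomial.mem_support_iff, coeff_coeffDeriv] at hi
      refine Finset.mem_erase.2 ⟨?_, hhs (MvPolynomial.mem_support_iff.2 ?_)⟩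
      · rintro rfl
        rw [hhm, Derivation.map_one_eq_zero] at hi
        exact hi rfl
      · intro h0
        rw [h0, map_zero] at hi
        exact hi rfl
    refine hmin _ ⟨hV h hhV, hne, (hsub.trans (Finset.erase_subset _ _)).trans hgs⟩ ?_
    exact (Finset.card_le_card hsub).trans_lt (Finset.card_erase_lt_of_mem hm)
  have hconst : h ∈ Set.range (MvPolynomial.map (σ := σ) (algebraMap C K)) := by
    rw [MvPolynomial.mem_range_map_iff_coeffs_subset]
    intro c hc
    obtain ⟨i, _, rfl⟩ := MvPolynomial.mem_coeffs_iff.1 hc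
    refine hD _ ?_
    rw [← coeff_coeffDeriv, hdh, MvPolynomial.coeff_zero]
  have hhspan : h ∈ Submodule.span K
      {g | g ∈ V ∧ g ∈ Set.range (MvPolynomial.map (σ := σ) (algebraMap C K))} :=
    Submodule.subset_span ⟨hhV, hconst⟩
  have hsub : (f - f.coeff m • h).support ⊆ f.support.erase m := by
    intro i hi
    rw [MvPolynomial.mem_support_iff, MvPolynomial.coeff_sub, MvPolynomial.coeff_smul] at hi
    refine Finset.mem_erase.2 ⟨?_, ?_⟩
    · rintro rfl
      simp [hhm] at hi
    · by_contra h0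
      have h1 : h.coeff i = 0 :=
        MvPolynomial.notMem_support_iff.1 fun h2 => h0 (hgs (hhs h2))
      rw [MvPolynomial.notMem_support_iff.1 h0, h1] at hi
      simp at hi
  have := ih _ (by
    rw [← hk]
    exact (Finset.card_le_card hsub).trans_lt (Finset.card_erase_lt_of_mem (hgs hm)))
    (V.sub_mem hf (V.smul_mem _ hhV)) rfl
  rw [← sub_add_cancel f (f.coeff m • h)]
  exact Submodule.add_mem _ this (Submodule.smul_mem _ _ hhspan)

/-! ### A rationality criterion in `K ⊗ K`. -/

section Nilpotent

variable {k K : Type*} [Field k] [Field K] [Algebra k K]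

/-- If `1 ⊗ w - w ⊗ 1` is nilpotent, any specialization of `w` over `k` equals `w`. -/
lemma eq_of_isNilpotent_tmul_sub {Ω : Type*} [Field Ω] [Algebra k Ω] [Algebra K Ω]
    [IsScalarTower k K Ω] {w : K}
    (hw : IsNilpotent ((1 : K) ⊗ₜ[k] w - w ⊗ₜ[k] (1 : K))) {x : Ω}
    (hx : ∀ p : Polynomial k, Polynomial.aeval w p = 0 → Polynomial.aeval x p = 0) :
    x = algebraMap K Ω w := by
  -- The specialization `w ↦ x` is defined only on `A ≅ k[w]`, not on `K`. Flatness of `K` over `k`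
  -- transfers the nilpotency from `K ⊗ K` to `K ⊗ A`, from where it can be sent to the field `Ω`.
  let A := Polynomial k ⧸ RingHom.ker (Polynomial.aeval (R := k) w)
  let ι : A →ₐ[k] K := Ideal.kerLiftAlg (Polynomial.aeval (R := k) w)
  have hι : Function.Injective ι := Ideal.kerLiftAlg_injective _
  let σ : A →ₐ[k] Ω := Ideal.Quotient.liftₐ _ (Polynomial.aeval x) fun p hp => hx p hp
  let t : A := Ideal.Quotient.mk _ Polynomial.X
  have hιt : ι t = w := (Ideal.kerLiftAlg_mk _ _).trans (Polynomial.aeval_X w)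
  have hσt : σ t = x := Polynomial.aeval_X x
  let j : K ⊗[k] A →ₐ[k] K ⊗[k] K := Algebra.TensorProduct.map (AlgHom.id k K) ι
  have hj : Function.Injective j := Module.Flat.lTensor_preserves_injective_linearMap
    (M := K) ι.toLinearMap hι
  have h1 : IsNilpotent ((1 : K) ⊗ₜ[k] t - w ⊗ₜ[k] (1 : A)) := by
    obtain ⟨N, hN⟩ := hw
    refine ⟨N, hj ?_⟩
    rw [map_pow, map_sub, map_zero]
    simpa [j, hιt] using hN
  have h2 := h1.map (Algebra.TensorProduct.lift (IsScalarTower.toAlgHom k K Ω) σ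
    fun _ _ => Commute.all _ _)
  rw [map_sub] at h2
  simp only [Algebra.TensorProduct.lift_tmul, map_one, one_mul, mul_one, hσt] at h2
  exact sub_eq_zero.1 h2.eq_zero

/-- All conjugates of `w` coincide with `w`. If `w` is algebraic, its minimal polynomial is
separable in characteristic zero and has a single root, hence degree one. -/
lemma mem_range_of_isNilpotent_tmul_sub [CharZero k] {w : K}
    (hw : IsNilpotent ((1 : K) ⊗ₜ[k] w - w ⊗ₜ[k] (1 : K))) : w ∈ (algebraMap k K).range := by
  by_cases halg : IsAlgebraic k w
  · have hint := halg.isIntegral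
    apply minpoly.mem_range_of_degree_eq_one
    have hsep : (minpoly k w).Separable := (minpoly.irreducible hint).separable
    have hcard := Polynomial.card_rootSet_eq_natDegree (K := AlgebraicClosure K) hsep
      (IsAlgClosed.splits _)
    have hsub : (minpoly k w).rootSet (AlgebraicClosure K) ⊆
        {algebraMap K (AlgebraicClosure K) w} := by
      intro x hx
      refine eq_of_isNilpotent_tmul_sub hw fun p hp => ?_
      obtain ⟨q, rfl⟩ := minpoly.dvd k w hp
      rw [map_mul, Polynomial.aeval_eq_zero_of_mem_rootSet hx, zero_mul]
    have hle : (minpoly k w).natDegree ≤ 1 := by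
      rw [← hcard, ← Nat.card_eq_fintype_card, Nat.card_coe_set_eq]
      exact (Set.ncard_le_ncard hsub).trans (Set.ncard_singleton _).le
    have := minpoly.natDegree_pos hint
    exact (Polynomial.degree_eq_iff_natDegree_eq_of_pos one_pos).2 (by omega)
  -- A transcendental `w` satisfies no relation, so `0` is an admissible specialization, and `w`
  -- would equal `0`.
  · have h0 : (0 : K) = algebraMap K K w := eq_of_isNilpotent_tmul_sub hw fun p hp => by
      have : p = 0 := by
        by_contra hne
        exact halg ⟨p, hne, hp⟩
      rw [this, map_zero]
    exact ⟨0, by rw [map_zero, h0]; rfl⟩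

end Nilpotent

/-! ### Relations of a fundamental matrix and rationality of its determinant. -/

section Systems

variable {n : ℕ}

lemma aeval_det_mvPolynomialX {B : Type*} [CommRing B] [Algebra ℂ B]
    (x : Fin n × Fin n → B) :
    MvPolynomial.aeval x (Matrix.mvPolynomialX (Fin n) (Fin n) ℂ).det =
      (Matrix.of fun i j => x (i, j)).det := by
  rw [AlgHom.map_det]
  congr 1
  ext i j
  simp

lemma aeval_translate {R B : Type*} [CommRing R] [Algebra ℂ R] [CommRing B] [Algebra R B]
    [Algebra ℂ B] [IsScalarTower ℂ R B] (y : Matrix (Fin n) (Fin n) B)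
    (g : Matrix (Fin n) (Fin n) ℂ) (P : MvPolynomial (Fin n × Fin n) R) :
    MvPolynomial.aeval (fun ij => y ij.1 ij.2) (translate R g P) =
      MvPolynomial.aeval (fun ij => (y * g.map (algebraMap ℂ B)) ij.1 ij.2) P := by
  rw [← AlgHom.comp_apply]
  congr 1
  refine MvPolynomial.algHom_ext fun ij => ?_
  simp only [translate, AlgHom.comp_apply, MvPolynomial.aeval_X, map_sum, map_mul,
    MvPolynomial.aeval_C, Matrix.mul_apply, Matrix.map_apply,
    ← IsScalarTower.algebraMap_apply ℂ R B]

variable {k K : Type*} [Field k] [Field K] [Algebra ℂ K] [Algebra k K]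

/-- The substitution `X ↦ y Z`. -/
def evalMulGeneric (y : Matrix (Fin n) (Fin n) K) :
    MvPolynomial (Fin n × Fin n) k →ₐ[k] MvPolynomial (Fin n × Fin n) K :=
  MvPolynomial.aeval fun ij =>
    (y.map (MvPolynomial.C (σ := Fin n × Fin n)) * Matrix.mvPolynomialX (Fin n) (Fin n) K)
      ij.1 ij.2

/-- For constant `Z` the matrix `y Z` solves the same system as `y`, so one polynomial `P'` computes
the derivative of both `P(y Z)` and `P(y)`. In particular `P(y) = 0` implies `P'(y) = 0`, which
makes the ideal generated by the `P(y Z)` differential. -/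
lemma exists_coeffDeriv_evalMulGeneric (D : Derivation ℂ K K) (d : k → k)
    (hd : ∀ x, D (algebraMap k K x) = algebraMap k K (d x))
    {y : Matrix (Fin n) (Fin n) K} {a : Matrix (Fin n) (Fin n) k}
    (hy : y.map D = a.map (algebraMap k K) * y) (P : MvPolynomial (Fin n × Fin n) k) :
    ∃ P' : MvPolynomial (Fin n × Fin n) k,
      coeffDeriv D (evalMulGeneric y P) = evalMulGeneric y P' ∧
      D (MvPolynomial.aeval (fun ij => y ij.1 ij.2) P) =
        MvPolynomial.aeval (fun ij => y ij.1 ij.2) P' := by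
  induction P using MvPolynomial.induction_on with
  | C x =>
    refine ⟨MvPolynomial.C (d x), ?_, ?_⟩
    · simp only [evalMulGeneric, MvPolynomial.aeval_C, MvPolynomial.algebraMap_apply,
        coeffDeriv_C, hd]
    · simp only [MvPolynomial.aeval_C, hd]
  | add P Q hP hQ =>
    obtain ⟨P', h1, h2⟩ := hP
    obtain ⟨Q', h3, h4⟩ := hQ
    exact ⟨P' + Q', by rw [map_add, coeffDeriv_add, h1, h3, map_add],
      by rw [map_add, map_add, h2, h4, map_add]⟩
  | mul_X P ij hP =>
    obtain ⟨P', h1, h2⟩ := hP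
    obtain ⟨Q', h3, h4⟩ : ∃ Q' : MvPolynomial (Fin n × Fin n) k,
        coeffDeriv D (evalMulGeneric (k := k) y (MvPolynomial.X ij)) = evalMulGeneric y Q' ∧
        D (MvPolynomial.aeval (fun ij => y ij.1 ij.2)
          (MvPolynomial.X ij : MvPolynomial (Fin n × Fin n) k)) =
        MvPolynomial.aeval (fun ij : Fin n × Fin n => y ij.1 ij.2) Q' := by
      have hy' (i j : Fin n) : D (y i j) = ∑ l, algebraMap k K (a i l) * y l j := by
        have := congrFun (congrFun hy i) j
        simpa [Matrix.mul_apply] using this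
      refine ⟨∑ l, MvPolynomial.C (a ij.1 l) * MvPolynomial.X (l, ij.2), ?_, ?_⟩
      · simp only [evalMulGeneric, MvPolynomial.aeval_X, map_sum, map_mul, MvPolynomial.aeval_C,
          Matrix.mul_apply, Matrix.map_apply, coeffDeriv_sum, coeffDeriv_mul, coeffDeriv_C, hy',
          Matrix.mvPolynomialX_apply, coeffDeriv_X, mul_zero, zero_add,
          MvPolynomial.algebraMap_apply, Finset.mul_sum]
        rw [Finset.sum_comm]
        refine Finset.sum_congr rfl fun i _ => Finset.sum_congr rfl fun j _ => ?_
        ring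
      · simp [hy', map_sum]
    exact ⟨P * Q' + MvPolynomial.X ij * P', by
        rw [map_mul, coeffDeriv_mul, h1, h3, map_add, map_mul, map_mul],
      by rw [map_mul, Derivation.leibniz, h2, h4, map_add, map_mul, map_mul]; rfl⟩

variable [Algebra ℂ k] [IsScalarTower ℂ k K]

/-- If all matrices preserving the relations of a fundamental matrix have determinant `1`, then
its determinant is rational. -/
lemma det_mem_range (D : Derivation ℂ K K) (d : k → k)
    (hd : ∀ x, D (algebraMap k K x) = algebraMap k K (d x))
    (hD : ∀ x, D x = 0 → x ∈ (algebraMap ℂ K).range)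
    {y : Matrix (Fin n) (Fin n) K} {a : Matrix (Fin n) (Fin n) k}
    (hy : y.map D = a.map (algebraMap k K) * y) (hdet : y.det ≠ 0)
    (hG : ∀ g : Matrix (Fin n) (Fin n) ℂ, g.det ≠ 0 →
      (∀ P : MvPolynomial (Fin n × Fin n) k, MvPolynomial.aeval (fun ij => y ij.1 ij.2) P = 0 →
        MvPolynomial.aeval (fun ij => y ij.1 ij.2) (translate k g P) = 0) → g.det = 1) :
    y.det ∈ (algebraMap k K).range := by
  have : CharZero k := charZero_of_injective_algebraMap (algebraMap ℂ k).injective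
  -- The equations `P(y Z) = 0`, `P` a relation of `y`: their complex solutions `Z` are the matrices
  -- carrying relations to relations.
  let 𝔞 : Ideal (MvPolynomial (Fin n × Fin n) K) :=
    Ideal.span (evalMulGeneric y '' {P : MvPolynomial (Fin n × Fin n) k |
      MvPolynomial.aeval (fun ij => y ij.1 ij.2) P = 0})
  have hstable : ∀ f ∈ 𝔞, coeffDeriv D f ∈ 𝔞 := by
    intro f hf
    induction hf using Submodule.span_induction with
    | mem f hf =>
      obtain ⟨P, hP, rfl⟩ := hf
      obtain ⟨P', h1, h2⟩ := exists_coeffDeriv_evalMulGeneric D d hd hy P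
      rw [h1]
      refine Ideal.subset_span ⟨P', ?_, rfl⟩
      rw [Set.mem_ofPred_eq, ← h2, show MvPolynomial.aeval _ P = _ from hP, map_zero]
    | zero =>
      have : coeffDeriv D (0 : MvPolynomial (Fin n × Fin n) K) = 0 := by ext; simp
      rw [this]; exact zero_mem _
    | add f g _ _ h1 h2 => rw [coeffDeriv_add]; exact add_mem h1 h2
    | smul c f hf h =>
      rw [smul_eq_mul, coeffDeriv_mul]
      exact add_mem (Ideal.mul_mem_left _ _ h) (Ideal.mul_mem_right _ _ hf)
  let 𝔞₀ : Ideal (MvPolynomial (Fin n × Fin n) ℂ) :=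
    𝔞.comap (MvPolynomial.map (algebraMap ℂ K))
  let δ : MvPolynomial (Fin n × Fin n) ℂ := (Matrix.mvPolynomialX (Fin n) (Fin n) ℂ).det
  -- Nullstellensatz. The factor `δ` takes care of the singular zeros, about which `hG` says
  -- nothing.
  have hrad : δ * (δ - 1) ∈ 𝔞₀.radical := by
    rw [← MvPolynomial.vanishingIdeal_zeroLocus_eq_radical (K := ℂ),
      MvPolynomial.mem_vanishingIdeal_iff]
    intro x hx
    rw [map_mul, map_sub, map_one, aeval_det_mvPolynomialX]
    by_cases h0 : (Matrix.of fun i j => x (i, j)).det = 0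
    · rw [h0, zero_mul]
    rw [hG _ h0, sub_self, mul_zero]
    intro P hP
    have hmem : evalMulGeneric y P ∈ 𝔞 := Ideal.subset_span ⟨P, hP, rfl⟩
    -- The point `x` is only known to kill the constant elements of `𝔞`; as these span `𝔞` over `K`,
    -- it kills `P(y Z)` as well.
    have hspan := mem_span_constants D hD (𝔞.restrictScalars K) hstable hmem
    have hz : ∀ f ∈ Submodule.span K {g | g ∈ 𝔞.restrictScalars K ∧
        g ∈ Set.range (MvPolynomial.map (σ := Fin n × Fin n) (algebraMap ℂ K))},
        MvPolynomial.aeval (fun ij => algebraMap ℂ K (x ij)) f = 0 := by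
      intro f hf
      induction hf using Submodule.span_induction with
      | mem f hf =>
        obtain ⟨hf, p, rfl⟩ := hf
        have h1 : MvPolynomial.aeval x p = 0 := hx p hf
        rw [MvPolynomial.aeval_map_algebraMap]
        have := MvPolynomial.aeval_algebraMap_apply K x p
        rw [h1, map_zero] at this
        exact this
      | zero => exact map_zero _
      | add f g _ _ h1 h2 => rw [map_add, h1, h2, add_zero]
      | smul c f _ h => rw [map_smul, h, smul_zero]
    have hzero := hz _ hspan
    rw [aeval_translate]
    have hcomp : ((MvPolynomial.aeval (R := K) fun ij => algebraMap ℂ K (x ij)).restrictScalars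
        k).comp (evalMulGeneric y) = MvPolynomial.aeval (R := k) fun ij =>
        (y * (Matrix.of fun i j => x (i, j)).map (algebraMap ℂ K)) ij.1 ij.2 := by
      refine MvPolynomial.algHom_ext fun ij => ?_
      simp [evalMulGeneric, Matrix.mul_apply]
    rw [← hcomp]
    exact hzero
  obtain ⟨N, hN⟩ := hrad
  have hN' : MvPolynomial.map (algebraMap ℂ K) ((δ * (δ - 1)) ^ N) ∈ 𝔞 := hN
  let iL : K →ₐ[K] K ⊗[k] K := Algebra.TensorProduct.includeLeft
  let iR : K →ₐ[k] K ⊗[k] K := Algebra.TensorProduct.includeRight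
  -- At this matrix `y Z` becomes `1 ⊗ y`, so `P(y Z)` becomes `1 ⊗ P(y)`. It is thus a zero of `𝔞`,
  -- with `det Z = (det y)⁻¹ ⊗ det y`.
  let Z : Matrix (Fin n) (Fin n) (K ⊗[k] K) := (y⁻¹).map iL * y.map iR
  let h : MvPolynomial (Fin n × Fin n) K →ₐ[K] K ⊗[k] K :=
    MvPolynomial.aeval fun ij => Z ij.1 ij.2
  have hyZ : y.map iL * Z = y.map iR := by
    have : y.map iL * (y⁻¹).map iL = 1 := by
      rw [← Matrix.map_mul, Matrix.mul_nonsing_inv _ (isUnit_iff_ne_zero.2 hdet)]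
      exact Matrix.map_one _ (map_zero _) (map_one _)
    rw [← Matrix.mul_assoc, this, Matrix.one_mul]
  have hcomp : (h.restrictScalars k).comp (evalMulGeneric y) =
      iR.comp (MvPolynomial.aeval fun ij => y ij.1 ij.2) := by
    refine MvPolynomial.algHom_ext fun ij => ?_
    have := congrFun (congrFun hyZ ij.1) ij.2
    simp only [Matrix.mul_apply, Matrix.map_apply] at this
    simp only [evalMulGeneric, AlgHom.comp_apply, MvPolynomial.aeval_X, ← this,
      Matrix.mul_apply, Matrix.map_apply, map_sum, map_mul, AlgHom.restrictScalars_apply,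
      Matrix.mvPolynomialX_apply, h, MvPolynomial.algHom_C]
    rfl
  have hh : ∀ f ∈ 𝔞, h f = 0 := by
    have hle : 𝔞 ≤ RingHom.ker h := by
      refine Ideal.span_le.2 ?_
      rintro _ ⟨P, hP, rfl⟩
      have := DFunLike.congr_fun hcomp P
      change h (evalMulGeneric y P) = 0
      refine this.trans ?_
      rw [AlgHom.comp_apply, show MvPolynomial.aeval _ P = _ from hP, map_zero]
    exact fun f hf => hle hf
  have hdetZ : iL y.det * Z.det = iR y.det := by
    have := congrArg Matrix.det hyZ
    rw [Matrix.det_mul] at this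
    rw [AlgHom.map_det, AlgHom.map_det]
    exact this
  have h1 : (Z.det * (Z.det - 1)) ^ N = 0 := by
    rw [← hh _ hN']
    have : h (MvPolynomial.map (algebraMap ℂ K) δ) = Z.det := by
      exact (MvPolynomial.aeval_map_algebraMap _ _ _).trans (aeval_det_mvPolynomialX _)
    rw [map_pow, map_mul, map_sub, map_one, map_pow, map_mul, map_sub, map_one, this]
  -- This allows the factor `δ` to be cancelled: `det Z - 1` is nilpotent, and so is `1 ⊗ det y -
  -- det y ⊗ 1`.
  have hu : IsUnit Z.det := by
    have : IsUnit (iR y.det) := (isUnit_iff_ne_zero.2 hdet).map iR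
    rw [← hdetZ] at this
    exact isUnit_of_mul_isUnit_right this
  apply mem_range_of_isNilpotent_tmul_sub
  refine ⟨N, ?_⟩
  have h2 : (Z.det - 1) ^ N = 0 := by
    rw [mul_pow] at h1
    exact (hu.pow N).mul_right_eq_zero.1 h1
  change (iR y.det - iL y.det) ^ N = 0
  rw [← hdetZ, show iL y.det * Z.det - iL y.det = iL y.det * (Z.det - 1) by ring, mul_pow, h2,
    mul_zero]

end Systems

end DifferentialAlgebra

/-! ### Galois groups of projectively equivalent systems -/

section Projective

lemma aeval_mul_of_isHomogeneous {σ R B : Type*} [CommSemiring R] [CommSemiring B] [Algebra R B]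
    {P : MvPolynomial σ R} {d : ℕ} (hP : P.IsHomogeneous d) (t : B) (x : σ → B) :
    MvPolynomial.aeval (fun i => t * x i) P = t ^ d * MvPolynomial.aeval x P := by
  rw [MvPolynomial.aeval_def, MvPolynomial.aeval_def, MvPolynomial.eval₂_eq,
    MvPolynomial.eval₂_eq, Finset.mul_sum]
  refine Finset.sum_congr rfl fun m hm => ?_
  have h := hP (MvPolynomial.mem_support_iff.1 hm)
  rw [Finsupp.weight_apply] at h
  simp only [Pi.one_apply, smul_eq_mul, mul_one, Finsupp.sum] at h
  rw [← h]
  simp only [mul_pow, Finset.prod_mul_distrib, Finset.prod_pow_eq_pow_sum]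
  ring

section Residues

variable {σ R : Type*} [CommRing R]

/-- The sum of the homogeneous components of degree `≡ r` modulo `n`, the component of degree `d`
being multiplied by `ν ^ (d / n)`. -/
def residuePart (n : ℕ) (ν : R) (r : ℕ) (P : MvPolynomial σ R) : MvPolynomial σ R :=
  ∑ d ∈ Finset.range (P.totalDegree + 1) with d % n = r,
    MvPolynomial.C (ν ^ (d / n)) * MvPolynomial.homogeneousComponent d P

lemma sum_residuePart {n : ℕ} (hn : 0 < n) (P : MvPolynomial σ R) :
    ∑ r ∈ Finset.range n, residuePart n 1 r P = P := by
  conv_rhs => rw [← MvPolynomial.sum_homogeneousComponent P]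
  rw [← Finset.sum_fiberwise_of_maps_to (s := Finset.range (P.totalDegree + 1))
    (t := Finset.range n) (g := (· % n)) fun d _ => Finset.mem_range.2 (Nat.mod_lt d hn)]
  simp [residuePart]

/-- The weights `ν ^ (d / n)` reduce each `t ^ d` to `t ^ (d % n)`. This serves twice: for roots of
unity with `ν = 1`, and for the scalar `t` between two full systems with `ν` the inverse of the
rational `t ^ n`. -/
lemma aeval_mul_residuePart {B : Type*} [CommRing B] [Algebra R B] {n : ℕ} {ν : R} {t : B}
    (ht : t ^ n * algebraMap R B ν = 1) (r : ℕ) (x : σ → B) (P : MvPolynomial σ R) :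
    MvPolynomial.aeval (fun i => t * x i) (residuePart n ν r P) =
      t ^ r * MvPolynomial.aeval x (residuePart n 1 r P) := by
  simp only [residuePart, map_sum, map_mul, MvPolynomial.aeval_C, Finset.mul_sum,
    aeval_mul_of_isHomogeneous (MvPolynomial.homogeneousComponent_isHomogeneous _ P)]
  refine Finset.sum_congr rfl fun d hd => ?_
  have hr := (Finset.mem_filter.1 hd).2
  have : t ^ d * algebraMap R B (ν ^ (d / n)) = t ^ r := by
    have hd' : t ^ d = (t ^ n) ^ (d / n) * t ^ r := by
      rw [← pow_mul, ← pow_add, ← hr, Nat.div_add_mod]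
    rw [hd', map_pow, mul_right_comm, ← mul_pow, ht, one_pow, one_mul]
  rw [← this]
  simp only [one_pow, map_one, one_mul]
  ring

end Residues

/-- If `∑ r < n, ζ ^ r * a r` vanishes for all `n`-th roots of unity `ζ`, then all `a r` vanish. -/
lemma eq_zero_of_sum_rootsOfUnity {K : Type*} [Field K] [Algebra ℂ K] {n : ℕ} (hn : 0 < n)
    (a : ℕ → K)
    (h : ∀ ζ : ℂ, ζ ^ n = 1 → ∑ r ∈ Finset.range n, algebraMap ℂ K ζ ^ r * a r = 0) :
    ∀ r < n, a r = 0 := by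
  let p : Polynomial K := ∑ r ∈ Finset.range n, Polynomial.monomial r (a r)
  have hp : p = 0 := by
    -- The degree is below `n`, while the `n` complex roots of unity give `n` distinct zeros.
    refine Polynomial.eq_zero_of_natDegree_lt_card_of_eval_eq_zero' p
      ((Polynomial.nthRootsFinset n (1 : ℂ)).map ⟨algebraMap ℂ K, (algebraMap ℂ K).injective⟩)
      ?_ ?_
    · intro x hx
      obtain ⟨ζ, hζ, rfl⟩ := Finset.mem_map.1 hx
      have := h ζ ((Polynomial.mem_nthRootsFinset hn 1).1 hζ)
      simpa [p, Polynomial.eval_finsetSum, Polynomial.eval_monomial, mul_comm] using this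
    · rw [Finset.card_map, (Complex.isPrimitiveRoot_exp n hn.ne').card_nthRootsFinset]
      refine (Polynomial.natDegree_sum_le_of_forall_le (n := n - 1) _ _ fun r hr => ?_).trans_lt
        (Nat.sub_lt hn one_pos)
      exact (Polynomial.natDegree_monomial_le _).trans
        (Nat.le_sub_one_of_lt (Finset.mem_range.1 hr))
  intro r hr
  have : p.coeff r = 0 := by rw [hp, Polynomial.coeff_zero]
  rw [Polynomial.finsetSum_coeff] at this
  simpa [Polynomial.coeff_monomial, hr] using this

/-- In a Noetherian ring, an ideal mapped into itself by a surjective endomorphism is its own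
preimage. -/
lemma comap_eq_of_le_comap {R : Type*} [CommRing R] [IsNoetherianRing R] {I : Ideal R}
    {f : R →+* R} (hf : Function.Surjective f) (h : I ≤ I.comap f) : I.comap f = I := by
  have hstep (m : ℕ) : I.comap (f ^ (m + 1)) = (I.comap f).comap (f ^ m) := by
    rw [Ideal.comap_comap, pow_succ']; rfl
  have hsurj (m : ℕ) : Function.Surjective (f ^ m) := by
    rw [RingHom.coe_pow]
    exact hf.iterate m
  -- The iterated preimages increase, hence stabilize at some `m`; surjectivity of `f ^ m` cancels
  -- it from the equality.
  have hmono : Monotone fun m => I.comap (f ^ m) :=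
    monotone_nat_of_le_succ fun m => by
      rw [hstep]; exact Ideal.comap_mono h
  obtain ⟨m, hm⟩ := WellFoundedGT.monotone_chain_condition ⟨_, hmono⟩
  have := hm (m + 1) (Nat.le_succ m)
  exact Ideal.comap_injective_of_surjective _ (hsurj m) ((hstep m).symm.trans this.symm)

variable {n : ℕ} {k K : Type*} [Field k] [Field K] [Algebra ℂ k] [Algebra ℂ K] [Algebra k K]
  [IsScalarTower ℂ k K]

/-- `g` preserves the ideal of polynomial relations over `k` between the entries of `y`. -/
def PreservesRelations (k : Type*) [Field k] [Algebra ℂ k] [Algebra k K]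
    (y : Matrix (Fin n) (Fin n) K) (g : Matrix (Fin n) (Fin n) ℂ) : Prop :=
  ∀ P : MvPolynomial (Fin n × Fin n) k, MvPolynomial.aeval (fun ij => y ij.1 ij.2) P = 0 ↔
    MvPolynomial.aeval (fun ij => y ij.1 ij.2) (translate k g P) = 0

-- Preservation in one direction suffices because the polynomial ring is Noetherian
-- (`comap_eq_of_le_comap`).
omit [IsScalarTower ℂ k K] [Algebra ℂ K] in
lemma PreservesRelations.of_imp {y : Matrix (Fin n) (Fin n) K} {g : Matrix (Fin n) (Fin n) ℂ}
    (hg : IsUnit g) (h : ∀ P : MvPolynomial (Fin n × Fin n) k,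
      MvPolynomial.aeval (fun ij => y ij.1 ij.2) P = 0 →
        MvPolynomial.aeval (fun ij => y ij.1 ij.2) (translate k g P) = 0) :
    PreservesRelations k y g := by
  obtain ⟨u, rfl⟩ := hg
  have hsurj : Function.Surjective (translate k (u : Matrix (Fin n) (Fin n) ℂ)) := fun P =>
    ⟨translate k (u⁻¹ : (Matrix (Fin n) (Fin n) ℂ)ˣ) P, by
      rw [← translate_mul, Units.mul_inv, translate_one]⟩
  have := comap_eq_of_le_comap (I := RingHom.ker (MvPolynomial.aeval (R := k)
    fun ij : Fin n × Fin n => y ij.1 ij.2))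
    (f := (translate k (u : Matrix (Fin n) (Fin n) ℂ)).toRingHom) hsurj h
  exact fun P => (SetLike.ext_iff.1 this P).symm

lemma PreservesRelations.aeval_eq_zero {y : Matrix (Fin n) (Fin n) K}
    {g : Matrix (Fin n) (Fin n) ℂ} (h : PreservesRelations k y g)
    {P : MvPolynomial (Fin n × Fin n) k} (hP : MvPolynomial.aeval (fun ij => y ij.1 ij.2) P = 0) :
    MvPolynomial.aeval (fun ij => (y * g.map (algebraMap ℂ K)) ij.1 ij.2) P = 0 := by
  rw [← aeval_translate]
  exact (h P).1 hP

/-- If `y₁ = t y c` with constant `c` and rational `t ^ n`, then every matrix preserving the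
relations of `y₁` is, after conjugation with `c`, an `n`-th root of unity times a matrix that
preserves the relations of `y`. -/
lemma PreservesRelations.exists_rootOfUnity (hn : 0 < n) {y y₁ : Matrix (Fin n) (Fin n) K} {t : K}
    (ht : t ≠ 0) (htn : t ^ n ∈ (algebraMap k K).range) {c : (Matrix (Fin n) (Fin n) ℂ)ˣ}
    (hy₁ : y₁ = t • (y * c.1.map (algebraMap ℂ K))) {g : (Matrix (Fin n) (Fin n) ℂ)ˣ}
    (hg : PreservesRelations k y₁ g.1) :
    ∃ ζ : ℂ, ζ ^ n = 1 ∧ PreservesRelations k y (ζ • (c * g * c⁻¹).1) := by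
  classical
  obtain ⟨μ, hμ⟩ := htn
  have hμ0 : μ ≠ 0 := by
    rintro rfl
    rw [map_zero] at hμ
    exact pow_ne_zero n ht hμ.symm
  have htν : t ^ n * algebraMap k K μ⁻¹ = 1 := by
    rw [← hμ, ← map_mul, mul_inv_cancel₀ hμ0, map_one]
  set z := y * c.1.map (algebraMap ℂ K) with hz
  let I (ζ : ℂ) : Ideal (MvPolynomial (Fin n × Fin n) k) :=
    RingHom.ker (MvPolynomial.aeval (R := k) fun ij : Fin n × Fin n =>
      algebraMap ℂ K ζ * z ij.1 ij.2)
  let J : Ideal (MvPolynomial (Fin n × Fin n) k) :=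
    RingHom.ker (MvPolynomial.aeval (R := k) fun ij : Fin n × Fin n =>
      (z * g.1.map (algebraMap ℂ K)) ij.1 ij.2)
  have hJ : J.IsPrime := RingHom.ker_isPrime _
  -- If `P` vanishes at all `ζ z`, each of its residue parts vanishes at `z`. Reweighted by powers
  -- of `μ⁻¹ ∈ k`, these parts are relations over `k` of `y₁ = t z`; `g` preserves them, and
  -- removing the powers of `t` gives `P(z g) = 0`.
  have hinf : (Polynomial.nthRootsFinset n (1 : ℂ)).inf I ≤ J := by
    intro P hP
    have hP' : ∀ ζ : ℂ, ζ ^ n = 1 → MvPolynomial.aeval (R := k) (fun ij : Fin n × Fin n =>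
        algebraMap ℂ K ζ * z ij.1 ij.2) P = 0 := fun ζ hζ =>
      (Finset.inf_le (f := I) ((Polynomial.mem_nthRootsFinset hn 1).2 hζ) :
        (Polynomial.nthRootsFinset n (1 : ℂ)).inf I ≤ I ζ) hP
    have hr : ∀ r < n, MvPolynomial.aeval (fun ij => z ij.1 ij.2) (residuePart n 1 r P) = 0 := by
      refine eq_zero_of_sum_rootsOfUnity hn _ fun ζ hζ => ?_
      have h1 := hP' ζ hζ
      conv_lhs at h1 => rw [← sum_residuePart hn P, map_sum]
      rw [← h1]
      refine Finset.sum_congr rfl fun r _ => (aeval_mul_residuePart ?_ _ _ _).symm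
      rw [map_one, mul_one, ← map_pow, hζ, map_one]
    have hr' : ∀ r < n, MvPolynomial.aeval (fun ij => (z * g.1.map (algebraMap ℂ K)) ij.1 ij.2)
        (residuePart n 1 r P) = 0 := by
      intro r hrn
      have h1 : MvPolynomial.aeval (fun ij => y₁ ij.1 ij.2) (residuePart n μ⁻¹ r P) = 0 := by
        rw [hy₁]
        have := aeval_mul_residuePart htν r (fun ij => z ij.1 ij.2) P
        rw [hr r hrn, mul_zero] at this
        exact this
      have h2 := hg.aeval_eq_zero h1
      rw [hy₁, Matrix.smul_mul] at h2
      have := aeval_mul_residuePart htν r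
        (fun ij => (z * g.1.map (algebraMap ℂ K)) ij.1 ij.2) P
      exact (mul_eq_zero.1 (this.symm.trans h2)).resolve_left (pow_ne_zero _ ht)
    change MvPolynomial.aeval _ P = 0
    conv_lhs => rw [← sum_residuePart hn P, map_sum]
    exact Finset.sum_eq_zero fun r hr => hr' r (Finset.mem_range.1 hr)
  -- A prime ideal containing a finite intersection contains one of its members, so a single root of
  -- unity works for all `P`.
  obtain ⟨ζ, hζ, hle⟩ := (Ideal.IsPrime.inf_le' hJ).1 hinf
  rw [Polynomial.mem_nthRootsFinset hn] at hζ
  have hζ0 : ζ ≠ 0 := by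
    rintro rfl
    rw [zero_pow hn.ne'] at hζ
    exact zero_ne_one hζ
  refine ⟨ζ⁻¹, by rw [inv_pow, hζ, inv_one], PreservesRelations.of_imp ?_ fun P hP => ?_⟩
  · have : IsUnit (ζ⁻¹ • (1 : Matrix (Fin n) (Fin n) ℂ)) :=
      ⟨⟨ζ⁻¹ • 1, ζ • 1, by simp [smul_smul, hζ0], by simp [smul_smul, hζ0]⟩, rfl⟩
    have h2 := this.mul (c * g * c⁻¹).isUnit
    rwa [smul_mul_assoc, one_mul] at h2
  · have hcc : c.1.map (algebraMap ℂ K) * (c⁻¹).1.map (algebraMap ℂ K) = 1 := by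
      rw [← Matrix.map_mul, Units.mul_inv, Matrix.map_one _ (map_zero _) (map_one _)]
    have hle' (Q : MvPolynomial (Fin n × Fin n) k)
        (hQ : MvPolynomial.aeval (fun ij => (algebraMap ℂ K ζ • z) ij.1 ij.2) Q = 0) :
        MvPolynomial.aeval (fun ij => (z * g.1.map (algebraMap ℂ K)) ij.1 ij.2) Q = 0 := hle hQ
    -- Since `y = (ζ z)(ζ⁻¹ c⁻¹)`, a relation of `y` is pulled back to one of `ζ z`, moved to `z g`,
    -- and read off at `z g (ζ⁻¹ c⁻¹) = y (ζ⁻¹ c g c⁻¹)`.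
    have h2 := hle' (translate k (ζ⁻¹ • (c⁻¹).1) P) (by
      rw [aeval_translate, hz]
      have : algebraMap ℂ K ζ • (y * c.1.map (algebraMap ℂ K)) *
          (ζ⁻¹ • (c⁻¹).1).map (algebraMap ℂ K) = y := by
        have hs : (ζ⁻¹ • (c⁻¹).1).map (algebraMap ℂ K) =
            algebraMap ℂ K ζ⁻¹ • (c⁻¹).1.map (algebraMap ℂ K) := by
          ext i j; simp
        rw [hs, Matrix.smul_mul, Matrix.mul_smul, smul_smul, ← map_mul, mul_inv_cancel₀ hζ0,
          map_one, one_smul, Matrix.mul_assoc, hcc, Matrix.mul_one]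
      rw [this]
      exact hP)
    rw [aeval_translate] at h2
    rw [aeval_translate, ← h2]
    have : y * (ζ⁻¹ • (c * g * c⁻¹).1).map (algebraMap ℂ K) =
        z * g.1.map (algebraMap ℂ K) * (ζ⁻¹ • (c⁻¹).1).map (algebraMap ℂ K) := by
      rw [hz, Matrix.mul_assoc, Matrix.mul_assoc, ← Matrix.map_mul, ← Matrix.map_mul,
        Units.val_mul, Units.val_mul, mul_smul_comm, mul_smul_comm, mul_assoc]
    rw [this]

lemma translate_smul {R : Type*} [CommRing R] [Algebra ℂ R] (ζ : ℂ)
    (g : Matrix (Fin n) (Fin n) ℂ) {P : MvPolynomial (Fin n × Fin n) R} {d : ℕ}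
    (hP : P.IsHomogeneous d) :
    translate R (ζ • g) P = MvPolynomial.C (algebraMap ℂ R ζ) ^ d * translate R g P := by
  unfold translate
  rw [← aeval_mul_of_isHomogeneous hP]
  congr 2
  funext ij
  simp only [Matrix.smul_apply, smul_eq_mul, map_mul, Finset.mul_sum]
  exact Finset.sum_congr rfl fun l _ => by ring

end Projective

/-! ### Morphisms of graded rings that are bijective in the degrees divisible by `n` -/

section Veronese

open AlgebraicGeometry CategoryTheory HomogeneousLocalization Graded

variable {A B : Type} [CommRing A] [Algebra ℂ A] [CommRing B] [Algebra ℂ B]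
  {𝒜 : ℕ → Submodule ℂ A} {ℬ : ℕ → Submodule ℂ B} [GradedAlgebra 𝒜] [GradedAlgebra ℬ]

/-- As `D₊(a) = D₊(a ^ n)`, the elements of degree divisible by `n` suffice to cover `Proj`. -/
lemma exists_mem_proj_basicOpen {n : ℕ} (hn : 0 < n) (x : Proj 𝒜) :
    ∃ d, 0 < d ∧ n ∣ d ∧ ∃ a ∈ 𝒜 d, x ∈ Proj.basicOpen 𝒜 a := by
  obtain ⟨⟨d, hd⟩, ⟨a, ha⟩, hx⟩ : ∃ i : PNat, ∃ a : 𝒜 i, x ∈ Proj.basicOpen 𝒜 (a : A) := by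
    have hx := (Proj.affineOpenCover 𝒜).covers x
    set i := (Proj.affineOpenCover 𝒜).idx x
    refine ⟨i.1, i.2, ?_⟩
    rw [← Proj.opensRange_awayι 𝒜 (i.2 : A) i.2.2 i.1.2]
    exact hx
  exact ⟨n • d, by simpa using ⟨hn, hd⟩, by simp, a ^ n, SetLike.pow_mem_graded n ha,
    by rwa [Proj.basicOpen_pow _ _ _ hn]⟩

/-- The homogeneous elements of positive degree divisible by `n`. -/
structure VeroneseIndex (𝒜 : ℕ → Submodule ℂ A) (n : ℕ) : Type where
  deg : ℕ
  elt : A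
  pos : 0 < deg
  dvd : n ∣ deg
  mem : elt ∈ 𝒜 deg

variable (f : 𝒜 →+*ᵍ ℬ) {n : ℕ} (hn : 0 < n)
  (hinj : Function.Injective f) (hsurj : ∀ d, n ∣ d → ∀ b ∈ ℬ d, ∃ a ∈ 𝒜 d, f a = b)

-- Elements of the homogeneous localization are fractions `a / s ^ m` with `deg a = m deg s`, again
-- divisible by `n`; this is why surjectivity in these degrees is enough.
include hinj hsurj in
lemma away_map_bijective {d : ℕ} (hd : n ∣ d) {s : A} (hs : s ∈ 𝒜 d) :
    Function.Bijective (Away.map f s) := by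
  constructor
  · rw [injective_iff_map_eq_zero]
    intro x hx
    obtain ⟨m, a, ha, rfl⟩ := Away.mk_surjective 𝒜 hs x
    rw [Away.map_mk, HomogeneousLocalization.ext_iff_val, HomogeneousLocalization.val_zero,
      Away.val_mk, ← Localization.mk_zero 1, Localization.mk_eq_mk_iff,
      Localization.r_iff_exists] at hx
    obtain ⟨⟨_, j, rfl⟩, hj⟩ := hx
    rw [HomogeneousLocalization.ext_iff_val, HomogeneousLocalization.val_zero,
      Away.val_mk, ← Localization.mk_zero 1, Localization.mk_eq_mk_iff,
      Localization.r_iff_exists]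
    refine ⟨⟨_, j, rfl⟩, hinj ?_⟩
    simpa using hj
  · intro y
    obtain ⟨m, b, hb, rfl⟩ := Away.mk_surjective ℬ (map_mem f hs) y
    obtain ⟨a, ha, rfl⟩ := hsurj (m • d) (hd.mul_left m) b hb
    exact ⟨Away.mk 𝒜 hs m a ha, by rw [Away.map_mk]⟩

lemma away_map_comp_awayMap {d e : ℕ} {s t : A} (hs : s ∈ 𝒜 d) (ht : t ∈ 𝒜 e) {x : A}
    (hx : x = s * t) :
    (Away.map f x).comp (awayMap 𝒜 ht hx) =
      (awayMap ℬ (map_mem f ht) ((congrArg f hx).trans (map_mul f s t))).comp (Away.map f s) := by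
  refine RingHom.ext fun z => ?_
  obtain ⟨m, a, ha, rfl⟩ := Away.mk_surjective 𝒜 hs z
  rw [RingHom.comp_apply, RingHom.comp_apply, awayMap_mk, Away.map_mk, Away.map_mk]
  erw [awayMap_mk]
  rw [HomogeneousLocalization.ext_iff_val, Away.val_mk, Away.val_mk]
  simp

/-- The restriction `D₊(f s) ⟶ D₊(s)` of the morphism induced by `f`. -/
abbrev specAwayMap (s : A) : Spec (.of (Away ℬ (f s))) ⟶ Spec (.of (Away 𝒜 s)) :=
  Spec.map (CommRingCat.ofHom (Away.map f s))

include hinj hsurj in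
lemma isIso_specAwayMap (j : VeroneseIndex 𝒜 n) : IsIso (specAwayMap f j.elt) := by
  have : IsIso (CommRingCat.ofHom (Away.map f j.elt)) :=
    (ConcreteCategory.isIso_iff_bijective _).2 (away_map_bijective f hinj hsurj j.dvd j.mem)
  infer_instance

lemma specAwayMap_comp_awayMap {d e : ℕ} {s t : A} (hs : s ∈ 𝒜 d) (ht : t ∈ 𝒜 e) {x : A}
    (hx : x = s * t) :
    specAwayMap f x ≫ Spec.map (CommRingCat.ofHom (awayMap 𝒜 ht hx)) =
      Spec.map (CommRingCat.ofHom (awayMap ℬ (map_mem f ht) ((congrArg f hx).trans (map_mul f s t)))) ≫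
        specAwayMap f s := by
  rw [← Spec.map_comp, ← Spec.map_comp, ← CommRingCat.ofHom_comp, ← CommRingCat.ofHom_comp,
    away_map_comp_awayMap f hs ht hx]

/-- The gluing condition for `veroneseMap`: on the overlap `D₊(f (s t))` both composites factor
through the chart `D₊(s t)`. -/
lemma fst_specAwayMap {d e : ℕ} {s t : A} (hs : s ∈ 𝒜 d) (hd : 0 < d) (ht : t ∈ 𝒜 e)
    (he : 0 < e) :
    Limits.pullback.fst (Proj.awayι ℬ (f s) (map_mem f hs) hd) (Proj.awayι ℬ (f t) (map_mem f ht) he) ≫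
        specAwayMap f s ≫ Proj.awayι 𝒜 s hs hd =
      Limits.pullback.snd (Proj.awayι ℬ (f s) (map_mem f hs) hd) (Proj.awayι ℬ (f t) (map_mem f ht) he) ≫
        specAwayMap f t ≫ Proj.awayι 𝒜 t ht he := by
  have hx : f (s * t) = f s * f t := map_mul f _ _
  rw [← cancel_epi (Proj.pullbackAwayιIso ℬ (map_mem f hs) hd (map_mem f ht) he hx).inv,
    Proj.pullbackAwayιIso_inv_fst_assoc, Proj.pullbackAwayιIso_inv_snd_assoc,
    ← Category.assoc, ← Category.assoc,
    ← specAwayMap_comp_awayMap f hs ht rfl, ← specAwayMap_comp_awayMap f ht hs (mul_comm _ _),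
    Category.assoc, Category.assoc, Proj.SpecMap_awayMap_awayι, Proj.SpecMap_awayMap_awayι]
  rfl

lemma fst_inv_specAwayMap {d e : ℕ} {s t : A} (hs : s ∈ 𝒜 d) (hd : 0 < d) (ht : t ∈ 𝒜 e)
    (he : 0 < e) [IsIso (specAwayMap f s)] [IsIso (specAwayMap f t)]
    [IsIso (specAwayMap f (s * t))] :
    Limits.pullback.fst (Proj.awayι 𝒜 s hs hd) (Proj.awayι 𝒜 t ht he) ≫
        inv (specAwayMap f s) ≫ Proj.awayι ℬ (f s) (map_mem f hs) hd =
      Limits.pullback.snd (Proj.awayι 𝒜 s hs hd) (Proj.awayι 𝒜 t ht he) ≫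
        inv (specAwayMap f t) ≫ Proj.awayι ℬ (f t) (map_mem f ht) he := by
  have h1 := specAwayMap_comp_awayMap f hs ht (x := s * t) rfl
  have h2 := specAwayMap_comp_awayMap f ht hs (x := s * t) (mul_comm _ _)
  rw [← IsIso.eq_inv_comp, ← Category.assoc, ← IsIso.comp_inv_eq] at h1 h2
  rw [← cancel_epi (Proj.pullbackAwayιIso 𝒜 hs hd ht he rfl).inv,
    Proj.pullbackAwayιIso_inv_fst_assoc, Proj.pullbackAwayιIso_inv_snd_assoc,
    ← Category.assoc, ← Category.assoc, h1, h2,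
    Category.assoc, Category.assoc, Proj.SpecMap_awayMap_awayι, Proj.SpecMap_awayMap_awayι]
  rfl

/-- The cover of `Proj ℬ` by the open sets `D₊(f s)`. -/
def veroneseCoverTarget : (Proj ℬ).AffineOpenCover where
  I₀ := VeroneseIndex 𝒜 n
  X j := .of (Away ℬ (f j.elt))
  f j := Proj.awayι ℬ (f j.elt) (map_mem f j.mem) j.pos
  idx x :=
    have h := exists_mem_proj_basicOpen hn x
    have h2 := hsurj h.choose h.choose_spec.2.1 h.choose_spec.2.2.choose
      h.choose_spec.2.2.choose_spec.1
    ⟨h.choose, h2.choose, h.choose_spec.1, h.choose_spec.2.1, h2.choose_spec.1⟩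
  covers x := by
    change x ∈ (Proj.awayι ℬ _ _ _).opensRange
    rw [Proj.opensRange_awayι]
    have h := exists_mem_proj_basicOpen hn x
    have h2 := hsurj h.choose h.choose_spec.2.1 h.choose_spec.2.2.choose
      h.choose_spec.2.2.choose_spec.1
    change x ∈ Proj.basicOpen ℬ (f h2.choose)
    rw [h2.choose_spec.2]
    exact h.choose_spec.2.2.choose_spec.2

variable (𝒜) in
/-- The cover of `Proj 𝒜` by the open sets `D₊(s)`, `s` homogeneous of degree divisible by `n`. -/
def veroneseCover : (Proj 𝒜).AffineOpenCover where
  I₀ := VeroneseIndex 𝒜 n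
  X j := .of (Away 𝒜 j.elt)
  f j := Proj.awayι 𝒜 j.elt j.mem j.pos
  idx x :=
    have h := exists_mem_proj_basicOpen hn x
    ⟨h.choose, h.choose_spec.2.2.choose, h.choose_spec.1, h.choose_spec.2.1,
      h.choose_spec.2.2.choose_spec.1⟩
  covers x := by
    change x ∈ (Proj.awayι 𝒜 _ _ _).opensRange
    rw [Proj.opensRange_awayι]
    exact (exists_mem_proj_basicOpen hn x).choose_spec.2.2.choose_spec.2

omit [GradedAlgebra 𝒜] in
include hn hsurj in
lemma veronese_target_hom_ext {Z : Scheme} {g h : Proj ℬ ⟶ Z}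
    (H : ∀ j : VeroneseIndex 𝒜 n, Proj.awayι ℬ (f j.elt) (map_mem f j.mem) j.pos ≫ g =
      Proj.awayι ℬ (f j.elt) (map_mem f j.mem) j.pos ≫ h) : g = h :=
  (veroneseCoverTarget f hn hsurj).openCover.hom_ext _ _ H

include hn in
lemma veronese_hom_ext {Z : Scheme} {g h : Proj 𝒜 ⟶ Z}
    (H : ∀ j : VeroneseIndex 𝒜 n, Proj.awayι 𝒜 j.elt j.mem j.pos ≫ g =
      Proj.awayι 𝒜 j.elt j.mem j.pos ≫ h) : g = h :=
  (veroneseCover 𝒜 hn).openCover.hom_ext _ _ H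

/-- The morphism `Proj ℬ ⟶ Proj 𝒜`. -/
def veroneseMap : Proj ℬ ⟶ Proj 𝒜 :=
  (veroneseCoverTarget f hn hsurj).openCover.glueMorphisms
    (fun j : VeroneseIndex 𝒜 n => specAwayMap f j.elt ≫ Proj.awayι 𝒜 j.elt j.mem j.pos)
    (fun i j : VeroneseIndex 𝒜 n => fst_specAwayMap f i.mem i.pos j.mem j.pos)

lemma awayι_veroneseMap (j : VeroneseIndex 𝒜 n) :
    Proj.awayι ℬ (f j.elt) (map_mem f j.mem) j.pos ≫ veroneseMap f hn hsurj =
      specAwayMap f j.elt ≫ Proj.awayι 𝒜 j.elt j.mem j.pos :=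
  (veroneseCoverTarget f hn hsurj).openCover.ι_glueMorphisms _ _ j

/-- The product of two homogeneous elements of positive degree divisible by `n`. -/
def VeroneseIndex.mul (i j : VeroneseIndex 𝒜 n) : VeroneseIndex 𝒜 n :=
  ⟨i.deg + j.deg, i.elt * j.elt, Nat.add_pos_left i.pos _, i.dvd.add j.dvd,
    SetLike.mul_mem_graded i.mem j.mem⟩

/-- `specAwayMap` as an isomorphism. -/
def specAwayIso (j : VeroneseIndex 𝒜 n) :
    Spec (.of (HomogeneousLocalization.Away ℬ (f j.elt))) ≅
      Spec (.of (HomogeneousLocalization.Away 𝒜 j.elt)) :=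
  @asIso _ _ _ _ (specAwayMap f j.elt) (isIso_specAwayMap f hinj hsurj j)

/-- The inverse of `veroneseMap`. -/
def veroneseInv : Proj 𝒜 ⟶ Proj ℬ :=
  (veroneseCover 𝒜 hn).openCover.glueMorphisms
    (fun j : VeroneseIndex 𝒜 n =>
      (specAwayIso f hinj hsurj j).inv ≫ Proj.awayι ℬ (f j.elt) (map_mem f j.mem) j.pos)
    (fun i j : VeroneseIndex 𝒜 n =>
      have := isIso_specAwayMap f hinj hsurj i
      have := isIso_specAwayMap f hinj hsurj j
      have : IsIso (specAwayMap f (i.elt * j.elt)) := isIso_specAwayMap f hinj hsurj (i.mul j)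
      fst_inv_specAwayMap f i.mem i.pos j.mem j.pos)

lemma awayι_veroneseInv (j : VeroneseIndex 𝒜 n) :
    Proj.awayι 𝒜 j.elt j.mem j.pos ≫ veroneseInv f hn hinj hsurj =
      (specAwayIso f hinj hsurj j).inv ≫ Proj.awayι ℬ (f j.elt) (map_mem f j.mem) j.pos :=
  (veroneseCover 𝒜 hn).openCover.ι_glueMorphisms _ _ j

/-- A morphism of graded rings that is bijective in the degrees divisible by `n` induces an
isomorphism of projective schemes. -/
def veroneseIso : Proj ℬ ≅ Proj 𝒜 where
  hom := veroneseMap f hn hsurj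
  inv := veroneseInv f hn hinj hsurj
  hom_inv_id := veronese_target_hom_ext f hn hsurj fun j => by
    rw [reassoc_of% awayι_veroneseMap f hn hsurj j, awayι_veroneseInv, Category.comp_id]
    exact (specAwayIso f hinj hsurj j).hom_inv_id_assoc _
  inv_hom_id := veronese_hom_ext hn fun j => by
    rw [reassoc_of% awayι_veroneseInv f hn hinj hsurj j, awayι_veroneseMap, Category.comp_id]
    exact (specAwayIso f hinj hsurj j).inv_hom_id_assoc _

/-- The structure morphism of `Proj 𝒜` over `ℂ`. -/
def projStr (𝒜 : ℕ → Submodule ℂ A) [GradedAlgebra 𝒜] :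
    Proj 𝒜 ⟶ Spec (CommRingCat.of ℂ) :=
  Proj.toSpecZero 𝒜 ≫ Spec.map (CommRingCat.ofHom (algebraMap ℂ (𝒜 0)))

lemma veroneseIso_hom_projStr (hf : ∀ c : ℂ, f (algebraMap ℂ A c) = algebraMap ℂ B c) :
    (veroneseIso f hn hinj hsurj).hom ≫ projStr 𝒜 = projStr ℬ := by
  refine veronese_target_hom_ext f hn hsurj fun j => ?_
  change _ ≫ veroneseMap f hn hsurj ≫ _ = _
  have key : (Away.map f j.elt).comp ((fromZeroRingHom 𝒜 (Submonoid.powers j.elt)).comp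
      (algebraMap ℂ (𝒜 0))) =
      (fromZeroRingHom ℬ (Submonoid.powers (f j.elt))).comp (algebraMap ℂ (ℬ 0)) := by
    refine RingHom.ext fun c => val_injective _ ?_
    change Localization.mk (f (algebraMap ℂ A c)) ⟨f 1, _⟩ =
      Localization.mk (algebraMap ℂ B c) ⟨1, _⟩
    simp only [hf, map_one]
  rw [reassoc_of% awayι_veroneseMap f hn hsurj j, projStr, projStr, Proj.awayι_toSpecZero_assoc,
    Proj.awayι_toSpecZero_assoc, ← Spec.map_comp, ← Spec.map_comp, ← Spec.map_comp,
    ← CommRingCat.ofHom_comp, ← CommRingCat.ofHom_comp, ← CommRingCat.ofHom_comp, key]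

/-- The projective scheme of a graded domain is integral as soon as it is not empty. -/
lemma isIntegral_proj [IsDomain A] {d : ℕ} (hd : 0 < d) {a : A} (ha : a ∈ 𝒜 d) (ha0 : a ≠ 0) :
    IsIntegral (Proj 𝒜) := by
  have hred : AlgebraicGeometry.IsReduced (Proj 𝒜) := by
    have h (i : (Proj.affineOpenCover 𝒜).openCover.I₀) :
        AlgebraicGeometry.IsReduced ((Proj.affineOpenCover 𝒜).openCover.X i) := by
      have : _root_.IsReduced (Away 𝒜 (i.2 : A)) := by
        exact isReduced_of_injective
          (algebraMap (Away 𝒜 (i.2 : A)) (Localization.Away (i.2 : A))) (val_injective _)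
      exact inferInstanceAs (AlgebraicGeometry.IsReduced (Spec (.of (Away 𝒜 (i.2 : A)))))
    exact AlgebraicGeometry.IsReduced.of_openCover _ (Proj.affineOpenCover 𝒜).openCover
  -- The generic point is the zero ideal; it belongs to `Proj` because `a` is a nonzero element of
  -- the irrelevant ideal.
  let η : ProjectiveSpectrum 𝒜 :=
    { asHomogeneousIdeal := ⊥
      isPrime := by
        rw [HomogeneousIdeal.toIdeal_bot]; exact Ideal.isPrime_bot
      not_irrelevant_le := fun h => ha0 (by
        have h1 : a ∈ HomogeneousIdeal.irrelevant 𝒜 := by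
          rw [HomogeneousIdeal.mem_irrelevant_iff, GradedRing.proj_apply,
            DirectSum.decompose_of_mem_ne 𝒜 ha hd.ne']
        have h2 : a ∈ (⊥ : HomogeneousIdeal 𝒜).toIdeal := h h1
        rwa [HomogeneousIdeal.toIdeal_bot, Ideal.mem_bot] at h2) }
  have hirr : IrreducibleSpace (Proj 𝒜) := by
    have hη : closure {η} = (Set.univ : Set (ProjectiveSpectrum 𝒜)) := by
      refine Set.eq_univ_of_forall fun x => (ProjectiveSpectrum.le_iff_mem_closure 𝒜 η x).1 ?_
      exact bot_le (a := x.asHomogeneousIdeal)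
    have := (isIrreducible_singleton (x := η)).closure
    rw [hη] at this
    have h2 : IrreducibleSpace (ProjectiveSpectrum 𝒜) := irreducibleSpace_def _ |>.2 this
    exact h2
  exact isIntegral_of_irreducibleSpace_of_isReduced _

end Veronese

/-! ### Functoriality of the non-singular model. -/

section Normalization

open AlgebraicGeometry CategoryTheory

/-- Isomorphic morphisms have isomorphic normalizations. -/
lemma exists_iso_normalization {X Y X₁ Y₁ : Scheme.{0}} (f : X ⟶ Y) (f₁ : X₁ ⟶ Y₁)
    [QuasiCompact f] [QuasiSeparated f] [QuasiCompact f₁] [QuasiSeparated f₁]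
    (e : X ≅ X₁) (ψ : Y ≅ Y₁) (h : e.hom ≫ f₁ = f ≫ ψ.hom) :
    ∃ φ : f.normalization ≅ f₁.normalization,
      φ.hom ≫ f₁.fromNormalization = f.fromNormalization ≫ ψ.hom := by
  -- The second factor is an integral morphism, so the universal property of the normalization of
  -- `f` yields a morphism to that of `f₁`.
  have H : f = (e.hom ≫ f₁.toNormalization) ≫ f₁.fromNormalization ≫ ψ.inv := by
    simp [reassoc_of% h]
  have h' : e.inv ≫ f = f₁ ≫ ψ.inv := by
    rw [Iso.inv_comp_eq, ← Category.assoc, h, Category.assoc, Iso.hom_inv_id, Category.comp_id]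
  have H₁ : f₁ = (e.inv ≫ f.toNormalization) ≫ f.fromNormalization ≫ ψ.hom := by
    simp [reassoc_of% h']
  have h1 := f.normalizationDesc_comp _ _ H
  have h2 := f₁.normalizationDesc_comp _ _ H₁
  have h1' : f.normalizationDesc _ _ H ≫ f₁.fromNormalization = f.fromNormalization ≫ ψ.hom := by
    rw [← Iso.comp_inv_eq, Category.assoc, h1]
  have h2' : f₁.normalizationDesc _ _ H₁ ≫ f.fromNormalization =
      f₁.fromNormalization ≫ ψ.inv := by
    rw [← cancel_mono ψ.hom, Category.assoc, h2, Category.assoc, Iso.inv_hom_id,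
      Category.comp_id]
  refine ⟨⟨f.normalizationDesc _ _ H, f₁.normalizationDesc _ _ H₁, ?_, ?_⟩, h1'⟩
  · refine Scheme.Hom.normalization.hom_ext f _ _ f.fromNormalization ?_ ?_ (by simp)
    · simp
    · rw [Category.assoc, h2', reassoc_of% h1']; simp
  · refine Scheme.Hom.normalization.hom_ext f₁ _ _ f₁.fromNormalization ?_ ?_ (by simp)
    · simp
    · rw [Category.assoc, h1', reassoc_of% h2']; simp

/-- An isomorphism of integral schemes lifts to their non-singular models. -/
lemma exists_iso_nonsingularModel {Z Z₁ : Scheme.{0}} [IsIntegral Z] [Z.IsSeparated]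
    [IsIntegral Z₁] [Z₁.IsSeparated] (ψ : Z ≅ Z₁) :
    ∃ φ : nonsingularModel Z ≅ nonsingularModel Z₁,
      φ.hom ≫ nonsingularModelMap Z₁ = nonsingularModelMap Z ≫ ψ.hom := by
  have hgen : ψ.hom (genericPoint Z) = genericPoint Z₁ :=
    genericPoint_eq_of_isOpenImmersion ψ.hom
  -- The point is left variable so that the equality of generic points can be substituted in the
  -- type of the stalk.
  have key (x₁ : Z₁) (hx : ψ.hom (genericPoint Z) = x₁) :
      ∃ e : Spec Z.functionField ≅ Spec (Z₁.presheaf.stalk x₁),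
        e.hom ≫ Z₁.fromSpecStalk x₁ = genericInclusion Z ≫ ψ.hom := by
    subst hx
    exact ⟨asIso (Spec.map (ψ.hom.stalkMap (genericPoint Z))),
      Scheme.SpecMap_stalkMap_fromSpecStalk ψ.hom⟩
  obtain ⟨e, he⟩ := key _ hgen
  exact exists_iso_normalization (genericInclusion Z) (genericInclusion Z₁) e ψ he

end Normalization

/-! ### Comparison of two fundamental matrices. -/

section Twist

variable {n : ℕ} {k K : Type*} [Field k] [Field K] [Algebra ℂ k] [Algebra ℂ K] [Algebra k K]
  [IsScalarTower ℂ k K]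

omit [IsScalarTower ℂ k K] [Algebra ℂ k] in
/-- Fundamental matrices of the systems with matrices `a` and `a + b` differ by a constant matrix
and a scalar factor. -/
lemma exists_eq_smul_mul (hn : 0 < n) (D : Derivation ℂ K K)
    (hD : ∀ x, D x = 0 → x ∈ (algebraMap ℂ K).range) {y y₁ : Matrix (Fin n) (Fin n) K}
    {a : Matrix (Fin n) (Fin n) k} {b : k} (hy : y.map D = a.map (algebraMap k K) * y)
    (hy₁ : y₁.map D = (a + Matrix.scalar (Fin n) b).map (algebraMap k K) * y₁)
    (hdet : y.det ≠ 0) (hdet₁ : y₁.det ≠ 0) :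
    ∃ (t : K) (c : (Matrix (Fin n) (Fin n) ℂ)ˣ), t ≠ 0 ∧
      y₁ = t • (y * c.1.map (algebraMap ℂ K)) := by
  classical
  have hu : IsUnit y.det := isUnit_iff_ne_zero.2 hdet
  set M := y⁻¹ * y₁ with hM
  have hyM : y * M = y₁ := by rw [hM, Matrix.mul_nonsing_inv_cancel_left _ _ hu]
  have hleib : (y * M).map D = y.map D * M + y * M.map D := by
    ext i j
    simp only [Matrix.map_apply, Matrix.mul_apply, map_sum, Derivation.leibniz, smul_eq_mul,
      Matrix.add_apply, ← Finset.sum_add_distrib]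
    exact Finset.sum_congr rfl fun l _ => by ring
  have hmap : (a + Matrix.scalar (Fin n) b).map (algebraMap k K) =
      a.map (algebraMap k K) + Matrix.scalar (Fin n) (algebraMap k K b) := by
    ext i j
    by_cases h : i = j <;> simp [h]
  have hDM : M.map D = algebraMap k K b • M := by
    have h1 : y * M.map D = algebraMap k K b • y₁ := by
      rw [hyM, hy₁, hy, hmap, Matrix.add_mul, Matrix.mul_assoc, hyM, add_right_inj,
        Matrix.scalar_apply, ← Matrix.smul_one_eq_diagonal, Matrix.smul_mul,
        Matrix.one_mul] at hleib
      exact hleib.symm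
    rw [hM, ← Matrix.mul_smul, ← h1, Matrix.nonsing_inv_mul_cancel_left _ _ hu, ← hM]
  have hM0 : M ≠ 0 := by
    rintro h0
    rw [h0, Matrix.mul_zero] at hyM
    have : Nonempty (Fin n) := ⟨⟨0, hn⟩⟩
    exact hdet₁ (by rw [← hyM, Matrix.det_zero])
  -- Any nonzero entry can serve as `t`: all entries satisfy `D m = b m`, so their quotients by it
  -- have derivative zero.
  obtain ⟨i₀, j₀, ht⟩ : ∃ i j, M i j ≠ 0 := by
    by_contra! h
    exact hM0 (Matrix.ext h)
  have hDe (i j : Fin n) : D (M i j) = algebraMap k K b * M i j :=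
    congrFun (congrFun hDM i) j
  have hc (i j : Fin n) : ∃ x : ℂ, algebraMap ℂ K x = M i j / M i₀ j₀ := by
    refine hD _ ?_
    have h1 : M i j = M i₀ j₀ * (M i j / M i₀ j₀) := by field_simp
    have h2 := hDe i j
    rw [h1, Derivation.leibniz, hDe i₀ j₀, smul_eq_mul, smul_eq_mul] at h2
    have h3 : M i₀ j₀ * D (M i j / M i₀ j₀) = 0 := by linear_combination h2
    exact (mul_eq_zero.1 h3).resolve_left ht
  choose x hx using hc
  have hMx : M = M i₀ j₀ • (Matrix.of x).map (algebraMap ℂ K) := by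
    ext i j
    simp only [Matrix.smul_apply, Matrix.map_apply, Matrix.of_apply, hx, smul_eq_mul]
    field_simp
  have hxdet : (Matrix.of x).det ≠ 0 := by
    intro h0
    have h1 : M.det = 0 := by
      rw [hMx, Matrix.det_smul, ← RingHom.mapMatrix_apply, ← RingHom.map_det, h0, map_zero,
        mul_zero]
    exact hdet₁ (by rw [← hyM, Matrix.det_mul, h1, mul_zero])
  refine ⟨M i₀ j₀, Matrix.nonsingInvUnit (Matrix.of x) (isUnit_iff_ne_zero.2 hxdet), ht, ?_⟩
  change y₁ = M i₀ j₀ • (y * (Matrix.of x).map (algebraMap ℂ K))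
  rw [← Matrix.mul_smul, ← hMx, hyM]

/-- Over the field of rational functions, the Galois groups of projectively equivalent unimodular
systems differ by conjugation and `n`-th roots of unity. -/
lemma exists_twist (hn : 0 < n) (D : Derivation ℂ K K) (d : k → k)
    (hd : ∀ x, D (algebraMap k K x) = algebraMap k K (d x))
    (hD : ∀ x, D x = 0 → x ∈ (algebraMap ℂ K).range) {y y₁ : Matrix (Fin n) (Fin n) K}
    {a : Matrix (Fin n) (Fin n) k} {b : k} (hy : y.map D = a.map (algebraMap k K) * y)
    (hy₁ : y₁.map D = (a + Matrix.scalar (Fin n) b).map (algebraMap k K) * y₁)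
    (hdet : y.det ≠ 0) (hdet₁ : y₁.det ≠ 0)
    (hG : ∀ g : (Matrix (Fin n) (Fin n) ℂ)ˣ, PreservesRelations k y g.1 → g.1.det = 1)
    (hG₁ : ∀ g : (Matrix (Fin n) (Fin n) ℂ)ˣ, PreservesRelations k y₁ g.1 → g.1.det = 1) :
    ∃ (t : K) (c : (Matrix (Fin n) (Fin n) ℂ)ˣ), t ≠ 0 ∧
      y₁ = t • (y * c.1.map (algebraMap ℂ K)) ∧
      (∀ g : (Matrix (Fin n) (Fin n) ℂ)ˣ, PreservesRelations k y₁ g.1 →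
        ∃ ζ : ℂ, ζ ^ n = 1 ∧ PreservesRelations k y (ζ • (c * g * c⁻¹).1)) ∧
      ∀ g : (Matrix (Fin n) (Fin n) ℂ)ˣ, PreservesRelations k y g.1 →
        ∃ ζ : ℂ, ζ ^ n = 1 ∧ PreservesRelations k y₁ (ζ • (c⁻¹ * g * c⁻¹⁻¹).1) := by
  have hGdet {y : Matrix (Fin n) (Fin n) K} (hG : ∀ g : (Matrix (Fin n) (Fin n) ℂ)ˣ,
      PreservesRelations k y g.1 → g.1.det = 1) (g : Matrix (Fin n) (Fin n) ℂ) (hg : g.det ≠ 0)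
      (h : ∀ P : MvPolynomial (Fin n × Fin n) k, MvPolynomial.aeval (fun ij => y ij.1 ij.2) P = 0 →
        MvPolynomial.aeval (fun ij => y ij.1 ij.2) (translate k g P) = 0) : g.det = 1 := by
    obtain ⟨u, rfl⟩ : IsUnit g := (Matrix.isUnit_iff_isUnit_det g).2 (isUnit_iff_ne_zero.2 hg)
    exact hG u (PreservesRelations.of_imp u.isUnit h)
  obtain ⟨w, hw⟩ := det_mem_range D d hd hD hy hdet (hGdet hG)
  obtain ⟨w₁, hw₁⟩ := det_mem_range D d hd hD hy₁ hdet₁ (hGdet hG₁)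
  obtain ⟨t, c, ht, hyc⟩ := exists_eq_smul_mul hn D hD hy hy₁ hdet hdet₁
  have hcdet : c.1.det ≠ 0 := ((Matrix.isUnit_iff_isUnit_det _).1 c.isUnit).ne_zero
  -- Taking determinants in `y₁ = t y c` expresses `t ^ n` through `det y`, `det y₁` and the
  -- constant `det c`.
  have htn : t ^ n ∈ (algebraMap k K).range := by
    have h1 : y₁.det = t ^ n * (y.det * algebraMap ℂ K c.1.det) := by
      rw [hyc, Matrix.det_smul, Fintype.card_fin, Matrix.det_mul, ← RingHom.mapMatrix_apply,
        ← RingHom.map_det]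
    have h2 : algebraMap ℂ K c.1.det ≠ 0 := by simpa using hcdet
    refine ⟨w₁ / (w * algebraMap ℂ k c.1.det), ?_⟩
    rw [map_div₀, map_mul, hw, hw₁, ← IsScalarTower.algebraMap_apply, h1]
    field_simp
  refine ⟨t, c, ht, hyc, fun g hg => hg.exists_rootOfUnity hn ht htn hyc, fun g hg =>
    hg.exists_rootOfUnity hn (inv_ne_zero ht) ?_ ?_⟩
  · rw [inv_pow]
    obtain ⟨μ, hμ⟩ := htn
    exact ⟨μ⁻¹, by rw [map_inv₀, hμ]⟩
  · have hcc : c.1.map (algebraMap ℂ K) * (c⁻¹).1.map (algebraMap ℂ K) = 1 := by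
      rw [← Matrix.map_mul, Units.mul_inv, Matrix.map_one _ (map_zero _) (map_one _)]
    rw [hyc, Matrix.smul_mul, smul_smul, inv_mul_cancel₀ ht, one_smul, Matrix.mul_assoc, hcc,
      Matrix.mul_one]

end Twist

/-! ### Invariants of twisted groups and homogeneous relations. -/

section Invariants

variable {n : ℕ}

lemma translate_inv_translate (c : (Matrix (Fin n) (Fin n) ℂ)ˣ)
    (P : MvPolynomial (Fin n × Fin n) ℂ) :
    translate ℂ (c⁻¹).1 (translate ℂ c.1 P) = P := by
  rw [← translate_mul, Units.inv_mul, translate_one]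

lemma translate_translate_inv (c : (Matrix (Fin n) (Fin n) ℂ)ˣ)
    (P : MvPolynomial (Fin n × Fin n) ℂ) :
    translate ℂ c.1 (translate ℂ (c⁻¹).1 P) = P := by
  rw [← translate_mul, Units.mul_inv, translate_one]

/-- The stabilizer of a polynomial. -/
def translateStabilizer (P : MvPolynomial (Fin n × Fin n) ℂ) :
    Subgroup (Matrix.GeneralLinearGroup (Fin n) ℂ) where
  carrier := {g | translate ℂ g.1 P = P}
  one_mem' := translate_one ℂ P
  mul_mem' {g h} (hg : translate ℂ g.1 P = P) (hh : translate ℂ h.1 P = P) := by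
    change translate ℂ (g.1 * h.1) P = P
    rw [translate_mul, hh, hg]
  inv_mem' {g} (hg : translate ℂ g.1 P = P) := by
    change translate ℂ (g⁻¹).1 P = P
    conv_lhs => rw [← hg]
    exact translate_inv_translate g P

/-- Up to conjugation by `c`, the group `G₁` is contained in the product of `G` and the group of
`n`-th roots of unity. -/
def IsTwistOf (G₁ G : Subgroup (Matrix.GeneralLinearGroup (Fin n) ℂ))
    (c : Matrix.GeneralLinearGroup (Fin n) ℂ) : Prop :=
  ∀ g ∈ G₁, ∃ ζ : ℂ, ζ ^ n = 1 ∧ ∃ h ∈ G, h.1 = ζ • (c * g * c⁻¹).1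

/-- In degree `d` the scalar `ζ` acts by `ζ ^ d = 1`, so a `G`-invariant `Q` is fixed by `c g c⁻¹`
itself. -/
lemma IsTwistOf.translate_mem {G₁ G : Subgroup (Matrix.GeneralLinearGroup (Fin n) ℂ)}
    {c : Matrix.GeneralLinearGroup (Fin n) ℂ} (h : IsTwistOf G₁ G c)
    {Q : MvPolynomial (Fin n × Fin n) ℂ} (hQ : Q ∈ invariants G) {d : ℕ} (hd : n ∣ d)
    (hQd : Q.IsHomogeneous d) : translate ℂ (c⁻¹).1 Q ∈ invariants G₁ := by
  intro g hg
  obtain ⟨ζ, hζ, u, hu, huζ⟩ := h g hg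
  have h1 : translate ℂ (c * g * c⁻¹).1 Q = Q := by
    have := hQ u hu
    obtain ⟨m, rfl⟩ := hd
    rw [huζ, translate_smul _ _ hQd, pow_mul, ← map_pow] at this
    simpa [hζ] using this
  conv_rhs => rw [← h1]
  rw [← translate_mul, ← translate_mul, ← Units.val_mul, ← Units.val_mul]
  congr 2
  group

variable {K : Type*} [CommRing K] [Algebra ℂ K]

/-- Evaluation of the invariants of `H` at a matrix. -/
def evalOn (H : Subgroup (Matrix.GeneralLinearGroup (Fin n) ℂ))
    (y : Matrix (Fin n) (Fin n) K) : invariants H →ₐ[ℂ] K :=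
  (MvPolynomial.aeval fun ij => y ij.1 ij.2).comp (invariants H).val

/-- The largest homogeneous ideal of invariants of `H` vanishing at a matrix. -/
def relIdeal (H : Subgroup (Matrix.GeneralLinearGroup (Fin n) ℂ))
    (y : Matrix (Fin n) (Fin n) K) : HomogeneousIdeal (invariantsDeg H) :=
  Ideal.homogeneousCore _ (RingHom.ker (evalOn H y))

lemma mem_relIdeal_of_mem_deg {H : Subgroup (Matrix.GeneralLinearGroup (Fin n) ℂ)}
    {y : Matrix (Fin n) (Fin n) K} {d : ℕ} {P : invariants H} (hP : P ∈ invariantsDeg H d) :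
    P ∈ (relIdeal H y).toIdeal ↔ evalOn H y P = 0 := by
  refine ⟨fun h => Ideal.toIdeal_homogeneousCore_le _ (RingHom.ker (evalOn H y)) h, fun h => ?_⟩
  exact Ideal.mem_homogeneousCore_of_homogeneous_of_mem ⟨d, hP⟩ h

lemma relIdeal_isPrime [IsDomain K] (H : Subgroup (Matrix.GeneralLinearGroup (Fin n) ℂ))
    (y : Matrix (Fin n) (Fin n) K) : (relIdeal H y).toIdeal.IsPrime :=
  Ideal.IsPrime.homogeneousCore (RingHom.ker_isPrime (evalOn H y))

/-- The determinant as an invariant of a unimodular group. -/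
lemma det_mem_invariants {H : Subgroup (Matrix.GeneralLinearGroup (Fin n) ℂ)}
    (hH : IsUnimodular H) :
    (Matrix.mvPolynomialX (Fin n) (Fin n) ℂ).det ∈ invariants H := by
  intro g hg
  have h := hH g hg
  unfold translate
  rw [aeval_det_mvPolynomialX]
  have : (Matrix.of fun i j => ∑ l, MvPolynomial.X (R := ℂ) (i, l) *
      MvPolynomial.C (algebraMap ℂ ℂ (g.1 l j))) =
      Matrix.mvPolynomialX (Fin n) (Fin n) ℂ * g.1.map MvPolynomial.C := by
    ext1 i j
    simp [Matrix.mul_apply]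
  rw [this, Matrix.det_mul, ← RingHom.mapMatrix_apply, ← RingHom.map_det, h, map_one, mul_one]

lemma isHomogeneous_det_mvPolynomialX :
    (Matrix.mvPolynomialX (Fin n) (Fin n) ℂ).det.IsHomogeneous n := by
  rw [Matrix.det_apply]
  refine MvPolynomial.IsHomogeneous.sum _ _ _ fun σ _ => ?_
  have h : (∏ i, Matrix.mvPolynomialX (Fin n) (Fin n) ℂ (σ i) i).IsHomogeneous n := by
    have := MvPolynomial.IsHomogeneous.prod Finset.univ
      (fun i => Matrix.mvPolynomialX (Fin n) (Fin n) ℂ (σ i) i) (fun _ => 1)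
      (fun i _ => MvPolynomial.isHomogeneous_X ℂ _)
    simpa using this
  rcases Int.units_eq_one_or (Equiv.Perm.sign σ) with hs | hs
  · rw [hs, one_smul]; exact h
  · rw [hs, Units.neg_smul, one_smul]; exact h.neg

/-- The determinant is invariant by unimodularity, has degree `n > 0` and does not vanish at `y`;
hence `Proj` of the graded domain is not empty. -/
lemma isIntegral_projOf_relIdeal [IsDomain K] (hn : 0 < n)
    {H : Subgroup (Matrix.GeneralLinearGroup (Fin n) ℂ)} (hH : IsUnimodular H)
    {y : Matrix (Fin n) (Fin n) K} (hy : y.det ≠ 0) :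
    AlgebraicGeometry.IsIntegral (projOf (invariantsDeg H) (relIdeal H y)) := by
  have := relIdeal_isPrime H y
  let δ : invariants H := ⟨_, det_mem_invariants hH⟩
  have hδ : δ ∈ invariantsDeg H n := isHomogeneous_det_mvPolynomialX
  have hmem : Ideal.Quotient.mk (relIdeal H y).toIdeal δ ∈
      quotientDeg (invariantsDeg H) (relIdeal H y).toIdeal n := ⟨δ, hδ, rfl⟩
  have hval : evalOn H y δ = y.det := aeval_det_mvPolynomialX _
  refine isIntegral_proj hn hmem ?_
  rw [Ne, Ideal.Quotient.eq_zero_iff_mem, mem_relIdeal_of_mem_deg hδ, hval]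
  exact hy

end Invariants

/-! ### Graded maps between quotients and their `Proj`. -/

section ProjMaps

open AlgebraicGeometry CategoryTheory Graded

variable {A B : Type} [CommRing A] [CommRing B] [Algebra ℂ A] [Algebra ℂ B]
  {𝒜 : ℕ → Submodule ℂ A} {ℬ : ℕ → Submodule ℂ B} [GradedAlgebra 𝒜] [GradedAlgebra ℬ]

/-- The morphism of graded quotient rings induced by a morphism of graded rings. -/
def quotientGradedMap (f : 𝒜 →+*ᵍ ℬ) (I : HomogeneousIdeal 𝒜) (J : HomogeneousIdeal ℬ)
    (hIJ : J.toIdeal.comap f = I.toIdeal) :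
    quotientDeg 𝒜 I.toIdeal →+*ᵍ quotientDeg ℬ J.toIdeal where
  toRingHom := Ideal.quotientMap J.toIdeal f.toRingHom hIJ.ge
  map_mem := by
    rintro d _ ⟨a, ha, rfl⟩
    exact ⟨f a, map_mem f ha, rfl⟩

lemma quotientGradedMap_mk (f : 𝒜 →+*ᵍ ℬ) (I : HomogeneousIdeal 𝒜) (J : HomogeneousIdeal ℬ)
    (hIJ : J.toIdeal.comap f = I.toIdeal) (a : A) :
    quotientGradedMap f I J hIJ (Ideal.Quotient.mk I.toIdeal a) =
      Ideal.Quotient.mk J.toIdeal (f a) :=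
  rfl

lemma quotientGradedMap_injective (f : 𝒜 →+*ᵍ ℬ) (I : HomogeneousIdeal 𝒜)
    (J : HomogeneousIdeal ℬ) (hIJ : J.toIdeal.comap f = I.toIdeal) :
    Function.Injective (quotientGradedMap f I J hIJ) := by
  refine (injective_iff_map_eq_zero _).2 fun a ha => ?_
  obtain ⟨a, rfl⟩ := Ideal.Quotient.mk_surjective a
  rw [quotientGradedMap_mk, Ideal.Quotient.eq_zero_iff_mem] at ha
  rw [Ideal.Quotient.eq_zero_iff_mem, ← hIJ]
  exact ha

lemma exists_projOf_iso_of_comap (f : 𝒜 →+*ᵍ ℬ) (I : HomogeneousIdeal 𝒜) (J : HomogeneousIdeal ℬ)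
    (hIJ : J.toIdeal.comap f = I.toIdeal) {n : ℕ} (hn : 0 < n)
    (hs : ∀ d, n ∣ d → ∀ b ∈ ℬ d, ∃ a ∈ 𝒜 d, f a = b)
    (hf : ∀ c : ℂ, f (algebraMap ℂ A c) = algebraMap ℂ B c) :
    ∃ ψ : projOf ℬ J ≅ projOf 𝒜 I, ψ.hom ≫ projOfStr 𝒜 I = projOfStr ℬ J := by
  have hs' : ∀ d, n ∣ d → ∀ b ∈ quotientDeg ℬ J.toIdeal d, ∃ a ∈ quotientDeg 𝒜 I.toIdeal d,
      quotientGradedMap f I J hIJ a = b := by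
    rintro d hd _ ⟨b, hb, rfl⟩
    obtain ⟨a, ha, rfl⟩ := hs d hd b hb
    exact ⟨Ideal.Quotient.mk I.toIdeal a, ⟨a, ha, rfl⟩, rfl⟩
  exact ⟨veroneseIso (quotientGradedMap f I J hIJ) hn (quotientGradedMap_injective f I J hIJ) hs',
    veroneseIso_hom_projStr (quotientGradedMap f I J hIJ) hn
      (quotientGradedMap_injective f I J hIJ) hs' fun c =>
        congrArg (Ideal.Quotient.mk J.toIdeal) (hf c)⟩

end ProjMaps

/-! ### The isomorphism between the projective varieties. -/

section InvariantMaps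

open Graded

variable {n : ℕ} {K : Type*} [CommRing K] [Algebra ℂ K]
  {H' H : Subgroup (Matrix.GeneralLinearGroup (Fin n) ℂ)}
  {c : Matrix.GeneralLinearGroup (Fin n) ℂ}

/-- The substitution `P ↦ P(X c)` from the invariants of `H'` to those of `H`, if
`c⁻¹ H c ⊆ H'`. -/
def translateInvariants (hc : ∀ h ∈ H, c⁻¹ * h * c ∈ H') :
    invariantsDeg H' →+*ᵍ invariantsDeg H where
  toRingHom := (((translate ℂ c.1).comp (invariants H').val).codRestrict (invariants H) (by
    rintro ⟨P, hP⟩ h hh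
    change translate ℂ h.1 (translate ℂ c.1 P) = translate ℂ c.1 P
    have h1 := hP _ (hc h hh)
    conv_rhs => rw [← h1]
    rw [← translate_mul, ← translate_mul, ← Units.val_mul, ← Units.val_mul]
    congr 2
    group)).toRingHom
  map_mem {_ _} hP := translate_isHomogeneous _ hP

lemma aeval_smul_mul {y y' : Matrix (Fin n) (Fin n) K} {t : K}
    (hy' : y' = t • (y * c.1.map (algebraMap ℂ K))) {P : MvPolynomial (Fin n × Fin n) ℂ} {d : ℕ}
    (hP : P.IsHomogeneous d) :
    MvPolynomial.aeval (fun ij => y' ij.1 ij.2) P =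
      t ^ d * MvPolynomial.aeval (fun ij => y ij.1 ij.2) (translate ℂ c.1 P) := by
  rw [aeval_translate, ← aeval_mul_of_isHomogeneous hP, hy']
  rfl

variable [IsDomain K] {y y' : Matrix (Fin n) (Fin n) K} {t : K}

/-- Homogeneous ideals are determined by their homogeneous elements, and on those of degree `d` the
two evaluations differ by the nonzero factor `t ^ d`. -/
lemma comap_relIdeal (hc : ∀ h ∈ H, c⁻¹ * h * c ∈ H') (ht : t ≠ 0)
    (hy' : y' = t • (y * c.1.map (algebraMap ℂ K))) :
    (relIdeal H y).toIdeal.comap (translateInvariants hc) = (relIdeal H' y').toIdeal := by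
  have hhom (d : ℕ) (P : invariants H') (hP : P ∈ invariantsDeg H' d) :
      translateInvariants hc P ∈ (relIdeal H y).toIdeal ↔ P ∈ (relIdeal H' y').toIdeal := by
    rw [mem_relIdeal_of_mem_deg hP, mem_relIdeal_of_mem_deg (map_mem (translateInvariants hc) hP)]
    have h1 : evalOn H' y' P = t ^ d * evalOn H y (translateInvariants hc P) :=
      aeval_smul_mul hy' hP
    rw [h1, mul_eq_zero, or_iff_right (pow_ne_zero d ht)]
  let J := (relIdeal H y).comap (translateInvariants hc)
  have hJ : J = relIdeal H' y' := by
    refine HomogeneousIdeal.ext' fun d P hP => ?_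
    exact hhom d P hP
  exact congrArg HomogeneousIdeal.toIdeal hJ

-- The inclusion `c⁻¹ H c ⊆ H'` makes the substitution a graded map in all degrees; `hsurj` supplies
-- preimages where `n` divides the degree, which is all that `Proj` needs.
open CategoryTheory in
lemma exists_projOf_iso (hn : 0 < n) (hc : ∀ h ∈ H, c⁻¹ * h * c ∈ H') (ht : t ≠ 0)
    (hy' : y' = t • (y * c.1.map (algebraMap ℂ K)))
    (hsurj : ∀ d, n ∣ d → ∀ Q ∈ invariants H, Q.IsHomogeneous d →
      translate ℂ (c⁻¹).1 Q ∈ invariants H') :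
    ∃ ψ : projOf (invariantsDeg H) (relIdeal H y) ≅ projOf (invariantsDeg H') (relIdeal H' y'),
      ψ.hom ≫ projOfStr (invariantsDeg H') (relIdeal H' y') =
        projOfStr (invariantsDeg H) (relIdeal H y) :=
  exists_projOf_iso_of_comap (translateInvariants hc) _ _ (comap_relIdeal hc ht hy') hn
    (fun d hd Q hQ => ⟨⟨_, hsurj d hd Q.1 Q.2 hQ⟩, translate_isHomogeneous _ hQ,
      Subtype.ext (translate_translate_inv c Q.1)⟩)
    fun z => Subtype.ext (AlgHom.commutes (translate ℂ c.1) z)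

open CategoryTheory in
/-- Twisted groups define the same projective variety. -/
lemma exists_projOf_iso_of_isTwistOf (hn : 0 < n)
    {G G₁ : Subgroup (Matrix.GeneralLinearGroup (Fin n) ℂ)}
    (h : IsTwistOf G₁ G c) (h₁ : IsTwistOf G G₁ c⁻¹) (ht : t ≠ 0)
    (hy' : y' = t • (y * c.1.map (algebraMap ℂ K))) :
    ∃ ψ : projOf (invariantsDeg G) (relIdeal G y) ≅ projOf (invariantsDeg G₁) (relIdeal G₁ y'),
      ψ.hom ≫ projOfStr (invariantsDeg G₁) (relIdeal G₁ y') =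
        projOfStr (invariantsDeg G) (relIdeal G y) := by
  -- Outside the degrees divisible by `n`, translation need not relate the invariants of `G` and
  -- `G₁`. The group generated by `G₁` and `c⁻¹ G c` has invariants that map to both algebras,
  -- bijectively in these degrees.
  let T : Subgroup (Matrix.GeneralLinearGroup (Fin n) ℂ) :=
    G₁ ⊔ G.map (MulAut.conj c⁻¹).toMonoidHom
  have hT {P : MvPolynomial (Fin n × Fin n) ℂ} (hP : P ∈ invariants G₁)
      (hP' : translate ℂ c.1 P ∈ invariants G) : P ∈ invariants T := by
    have hle : T ≤ translateStabilizer P := by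
      refine sup_le (fun g hg => hP g hg) ?_
      rintro _ ⟨g, hg, rfl⟩
      change translate ℂ (c⁻¹ * g * c⁻¹⁻¹).1 P = P
      rw [inv_inv, Units.val_mul, Units.val_mul, translate_mul, translate_mul, hP' g hg,
        translate_inv_translate]
    exact fun g hg => hle hg
  obtain ⟨ψ, hψ⟩ := exists_projOf_iso (H := G) (H' := T) hn
    (fun g hg => (le_sup_right : _ ≤ T) ⟨g, hg, by simp⟩) ht hy' fun d hd Q hQ hQd =>
      hT (h.translate_mem hQ hd hQd) (by rwa [translate_translate_inv])
  obtain ⟨ψ₁, hψ₁⟩ := exists_projOf_iso (H := G₁) (H' := T) (c := 1) (t := (1 : K)) (y := y')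
    (y' := y') hn (fun g hg => by
      rw [inv_one, one_mul, mul_one]; exact (le_sup_left : _ ≤ T) hg) one_ne_zero
    (by rw [Units.val_one, Matrix.map_one _ (map_zero _) (map_one _), Matrix.mul_one, one_smul])
    fun d hd Q hQ hQd => by
      rw [inv_one, Units.val_one, translate_one]
      have := h₁.translate_mem hQ hd hQd
      rw [inv_inv] at this
      exact hT hQ this
  refine ⟨ψ ≪≫ ψ₁.symm, ?_⟩
  rw [Iso.trans_hom, Iso.symm_hom, Category.assoc, ← hψ, Iso.cancel_iso_hom_left,
    Iso.inv_comp_eq, hψ₁]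

end InvariantMaps

/-! ### Equality of the function fields. -/

section Functions

variable {n : ℕ} {X : Type*} [TopologicalSpace X] [ChartedSpace ℂ X]
  {U : TopologicalSpace.Opens X} [IsDomain (Mero X U)]

/-- Writing `P / Q = P Q ^ (n - 1) / Q ^ n` raises the degree to `n d`. There translation by `c⁻¹`
gives invariants of the other group, whose values at `y₁` carry the common factor `t ^ (n d)`, which
cancels. -/
lemma fanoFunctions_subset (hn : 0 < n) {y y₁ : Matrix (Fin n) (Fin n) (Mero X U)}
    {c : Matrix.GeneralLinearGroup (Fin n) ℂ} {t : Mero X U}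
    (h : IsTwistOf (galoisGroup y₁) (galoisGroup y) c) (ht : t ≠ 0)
    (hy₁ : y₁ = t • (y * c.1.map (algebraMap ℂ (Mero X U)))) :
    fanoFunctions y ⊆ fanoFunctions y₁ := by
  rintro r ⟨d, P, Q, hP, hQ, hQ0, hr⟩
  have hmem (R : invariants (galoisGroup y)) (hR : R ∈ invariantsDeg (galoisGroup y) (n * d)) :
      ∃ R' ∈ invariantsDeg (galoisGroup y₁) (n * d),
        evalInvariants y₁ R' = t ^ (n * d) * evalInvariants y R := by
    refine ⟨⟨_, h.translate_mem R.2 (dvd_mul_right n d) hR⟩, translate_isHomogeneous _ hR, ?_⟩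
    refine (aeval_smul_mul hy₁ (translate_isHomogeneous _ hR)).trans ?_
    rw [translate_translate_inv]
    rfl
  obtain ⟨m, hm⟩ : ∃ m, n = m + 1 := ⟨n - 1, by omega⟩
  have hQm (i : ℕ) : Q ^ i ∈ invariantsDeg (galoisGroup y) (i * d) :=
    SetLike.pow_mem_graded i hQ
  have hPQ : P * Q ^ m ∈ invariantsDeg (galoisGroup y) (n * d) := by
    have hidx : d + m * d = n * d := by rw [hm]; ring
    exact hidx ▸ SetLike.mul_mem_graded hP (hQm m)
  obtain ⟨P', hP', hPe⟩ := hmem _ hPQ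
  obtain ⟨Q', hQ', hQe⟩ := hmem _ (hQm n)
  refine ⟨_, P', Q', hP', hQ', ?_, ?_⟩
  · rw [hQe, map_pow]
    exact mul_ne_zero (pow_ne_zero _ ht) (pow_ne_zero _ hQ0)
  · rw [hPe, hQe, map_mul, map_pow, map_pow, ← hr]
    have hpow : evalInvariants y Q ^ n = evalInvariants y Q ^ m * evalInvariants y Q := by
      rw [← pow_succ, ← hm]
    rw [hpow]
    ring

end Functions

/-! ### Connection matrices under projective equivalence. -/

section Connections

variable {X : Type*} [TopologicalSpace X] [ChartedSpace ℂ X] [IsManifold 𝓘(ℂ, ℂ) ω X] [T2Space X]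
  {v : MeroField X} {E : Type*} [AddCommGroup E] [Module (Mero X ⊤) E]
  {L : Type*} [AddCommGroup L] [Module (Mero X ⊤) L] {n : ℕ}

/-- The matrices of projectively equivalent connections in corresponding frames differ by a scalar
matrix. -/
lemma Connection.exists_matrix_eq_add_scalar (C C₁ : Connection v E) (C' : Connection v L)
    (τ : E ≃ₗ[Mero X ⊤] L ⊗[Mero X ⊤] E)
    (hτ : ∀ V : E, τ (C₁.toFun V) = (C'.tensor C).toFun (τ V))
    (e e₁ : Module.Basis (Fin n) (Mero X ⊤) E) (s : Module.Basis Unit (Mero X ⊤) L)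
    (he : ∀ i, τ (e₁ i) = s () ⊗ₜ[Mero X ⊤] e i) :
    ∃ b, C₁.matrix e₁ = C.matrix e + Matrix.scalar (Fin n) b := by
  obtain ⟨b, hb⟩ : ∃ b : Mero X ⊤, C'.toFun (s ()) = b • s () := by
    refine ⟨s.repr (C'.toFun (s ())) (), ?_⟩
    conv_lhs => rw [← s.sum_repr (C'.toFun (s ()))]
    simp
  have hC (j : Fin n) : C₁.toFun (e₁ j) =
      b • e₁ j + ∑ i, e.repr (C.toFun (e j)) i • e₁ i := by
    apply τ.injective
    rw [hτ, he]
    change C'.toFun (s ()) ⊗ₜ e j + s () ⊗ₜ C.toFun (e j) = _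
    conv_lhs => rw [← e.sum_repr (C.toFun (e j))]
    simp only [hb, map_add, map_smul, map_sum, he, TensorProduct.smul_tmul',
      TensorProduct.tmul_sum, TensorProduct.tmul_smul]
  -- The sign comes from the convention `∇ e_j = - ∑ i, a i j • e_i`.
  refine ⟨-b, ?_⟩
  ext i j
  simp only [Connection.matrix, Matrix.of_apply, Matrix.add_apply, hC]
  rw [map_add, map_smul, map_sum]
  simp only [map_smul, Module.Basis.repr_self, Finsupp.add_apply, Finsupp.smul_apply,
    Finsupp.coe_finsetSum, Finset.sum_apply, Finsupp.single_apply, smul_eq_mul, mul_ite, mul_one,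
    mul_zero, Finset.sum_ite_eq', Finset.mem_univ, if_true, Matrix.scalar_apply,
    Matrix.diagonal_apply, eq_comm (a := j)]
  split_ifs <;> ring

end Connections

/-! ### From differential fields back to meromorphic functions. -/

section Twist

variable {X : Type*} [TopologicalSpace X] [ChartedSpace ℂ X] [IsManifold 𝓘(ℂ, ℂ) ω X] [T2Space X]
  [ConnectedSpace X] {n : ℕ} {U : TopologicalSpace.Opens X}

/-- The Galois groups of unimodular systems with matrices `a` and `a + b` are twists of each
other. -/
lemma exists_isTwistOf {v : MeroField X} (hv : v.IsNonzero) (hn : 0 < n)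
    (hU : IsConnected (U : Set X)) {y y₁ : Matrix (Fin n) (Fin n) (Mero X U)}
    {a : Matrix (Fin n) (Fin n) (Mero X ⊤)} {b : Mero X ⊤}
    (hy : y.map (v.derivation U) = a.map (restrict U) * y)
    (hy₁ : y₁.map (v.derivation U) = (a + Matrix.scalar (Fin n) b).map (restrict U) * y₁)
    (hdet : y.det ≠ 0) (hdet₁ : y₁.det ≠ 0)
    (huni : IsUnimodular (galoisGroup y)) (huni₁ : IsUnimodular (galoisGroup y₁)) :
    ∃ (t : Mero X U) (c : Matrix.GeneralLinearGroup (Fin n) ℂ), t ≠ 0 ∧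
      y₁ = t • (y * c.1.map (algebraMap ℂ (Mero X U))) ∧
      IsTwistOf (galoisGroup y₁) (galoisGroup y) c ∧
      IsTwistOf (galoisGroup y) (galoisGroup y₁) c⁻¹ := by
  let _ : Field (Mero X U) := Mero.field hU
  let _ : Field (Mero X ⊤) := Mero.field (U := ⊤) isConnected_univ
  let _ : Algebra (Mero X ⊤) (Mero X U) := (restrict U).toRingHom.toAlgebra
  have : IsScalarTower ℂ (Mero X ⊤) (Mero X U) :=
    IsScalarTower.of_algebraMap_eq fun z => ((restrict U).commutes z).symm
  obtain ⟨t, c, ht, hyc, h, h₁⟩ := exists_twist (k := Mero X ⊤) (K := Mero X U) hn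
    (v.derivation U) (v.derivation ⊤) v.derivation_restrict
    (fun x hx => MeroField.mem_range_of_derivation_eq_zero hv hU hx) hy hy₁ hdet hdet₁ huni huni₁
  have hunit {ζ : ℂ} (hζ : ζ ^ n = 1) (g : Matrix.GeneralLinearGroup (Fin n) ℂ) :
      ∃ u : Matrix.GeneralLinearGroup (Fin n) ℂ, u.1 = ζ • g.1 :=
    (g.isUnit.smul (Units.mk0 ζ fun h0 => by
      rw [h0, zero_pow hn.ne'] at hζ; exact zero_ne_one hζ))
  refine ⟨t, c, ht, hyc, fun g hg => ?_, fun g hg => ?_⟩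
  · obtain ⟨ζ, hζ, hP⟩ := h g hg
    obtain ⟨u, hu⟩ := hunit hζ (c * g * c⁻¹)
    exact ⟨ζ, hζ, u, by rw [← hu] at hP; exact hP, hu⟩
  · obtain ⟨ζ, hζ, hP⟩ := h₁ g hg
    obtain ⟨u, hu⟩ := hunit hζ (c⁻¹ * g * c⁻¹⁻¹)
    exact ⟨ζ, hζ, u, by rw [← hu] at hP; exact hP, hu⟩

end Twist

end FanoCurve

end

open AlgebraicGeometry CategoryTheory FanoCurve in
theorem mainTheorem10
    {X : Type*} [TopologicalSpace X] [ChartedSpace ℂ X] [IsManifold 𝓘(ℂ, ℂ) ω X]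
    [T2Space X] [CompactSpace X] [ConnectedSpace X]
    (v : MeroField X) (hv : v.IsNonzero)
    {n : ℕ} (hn : 0 < n)
    {E : Type*} [AddCommGroup E] [Module (Mero X ⊤) E]
    {L : Type*} [AddCommGroup L] [Module (Mero X ⊤) L]
    (C C₁ : Connection v E) (C' : Connection v L)
    (τ : E ≃ₗ[Mero X ⊤] L ⊗[Mero X ⊤] E)
    (hτ : ∀ V : E, τ (C₁.toFun V) = (C'.tensor C).toFun (τ V))
    (e e₁ : Module.Basis (Fin n) (Mero X ⊤) E) (s : Module.Basis Unit (Mero X ⊤) L)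
    (he : ∀ i, τ (e₁ i) = s () ⊗ₜ[Mero X ⊤] e i)
    (U : TopologicalSpace.Opens X) (hU : IsConnected (U : Set X))
    (y y₁ : Matrix (Fin n) (Fin n) (Mero X U))
    (hy : C.IsFullSystem e U y) (hy₁ : C₁.IsFullSystem e₁ U y₁)
    (hred : IsReductive (galoisGroup y)) (huni : IsUnimodular (galoisGroup y))
    (huni₁ : IsUnimodular (galoisGroup y₁)) :
    fanoFunctions y = fanoFunctions y₁ ∧
    ∃ (_ : IsIntegral (fanoVariety y)) (_ : IsIntegral (fanoVariety y₁))
      (ψ : fanoVariety y ≅ fanoVariety y₁) (φ : fanoCurve y ≅ fanoCurve y₁),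
      ψ.hom ≫ fanoVarietyStr y₁ = fanoVarietyStr y ∧
      φ.hom ≫ fanoCurveMap y₁ = fanoCurveMap y ≫ ψ.hom := by
  have : IsDomain (Mero X U) := (Mero.isField hU).isDomain
  obtain ⟨b, hb⟩ := C.exists_matrix_eq_add_scalar C₁ C' τ hτ e e₁ s he
  have hy₁' := hy₁.1
  rw [hb] at hy₁'
  obtain ⟨t, c, ht, hyc, h, h₁⟩ :=
    exists_isTwistOf hv hn hU hy.1 hy₁' hy.2 hy₁.2 huni huni₁
  -- With `t⁻¹` and `c⁻¹` the roles of `y` and `y₁` are exchanged, for the reverse inclusion of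
  -- function fields.
  obtain ⟨t', ht'⟩ := (Mero.isField hU).mul_inv_cancel ht
  have ht0 : t' ≠ 0 := right_ne_zero_of_mul_eq_one ht'
  have hyc' : y = t' • (y₁ * (c⁻¹).1.map (algebraMap ℂ (Mero X U))) := by
    rw [hyc, Matrix.smul_mul, smul_smul, mul_comm, ht', one_smul, Matrix.mul_assoc,
      ← Matrix.map_mul, Units.mul_inv, Matrix.map_one _ (map_zero _) (map_one _), Matrix.mul_one]
  have hZ : IsIntegral (fanoVariety y) := isIntegral_projOf_relIdeal hn huni hy.2
  have hZ₁ : IsIntegral (fanoVariety y₁) := isIntegral_projOf_relIdeal hn huni₁ hy₁.2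
  obtain ⟨ψ, hψ⟩ := exists_projOf_iso_of_isTwistOf hn h h₁ ht hyc
  obtain ⟨φ, hφ⟩ := exists_iso_nonsingularModel (Z := fanoVariety y) (Z₁ := fanoVariety y₁) ψ
  exact ⟨(fanoFunctions_subset hn h ht hyc).antisymm (fanoFunctions_subset hn h₁ ht0 hyc'),
    hZ, hZ₁, ψ, φ, hψ, hφ⟩
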